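/- Call a non-decreasing function $f:(0,1]\to(0,1]$ a hierarchy function. For a finite graph $F$: a cut of $F$ is a partition $\{X,Y\}$ of $V(F)$ into two non-empty sets; it is $\alpha$-sparse if at most $\alpha|X||Y|$ edges of $F$ join $X$ to $Y$. $F$ is bipartite and balanced if $V(F)$ can be partitioned into two independent sets of equal size. A perfect $K_{t,t}$-packing in $F$ is a collection of pairwise vertex-disjoint subgraphs of $F$, each isomorphic to $K_{t,t}$, that together cover $V(F)$. The subgraph of $F$ induced by $S\subseteq V(F)$ is denoted by $F[S]$. Let $f_0,f_1,f_2,f_3$ be hierarchy functions, let $0<c\le 1$ and let $t\ge 2$ be an integer. Then, for every sufficiently large integer $n_0$ (depending only on $c$, $t$ and $f_0,\dots,f_3$), the following holds. Let $G$ be a $d$-regular graph on $n$ vertices, where $n\ge n_0$ and $d\ge cn$. Then there exist real numbers $\eta,\zeta,\gamma>0$ and an integer $r$ with $1\le r\le\lceil 1/c\rceil$ such that $$\frac1{n_0}\le f_0(\eta),\qquad \eta\le f_1(\zeta),\qquad \zeta\le f_2(\gamma),\qquad \gamma\le f_3\bigl(\min\{c,1/t\}\bigr)$$ (that is, $1/n_0\ll\eta\ll\zeta\ll\gamma\ll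 c,1/t$), and there exist pairwise disjoint sets $Z_1,\dots,Z_r,L\subseteq V(G)$, with every $Z_i$ non-empty, and a spanning subgraph $G'\subseteq G$ with the following properties. 1. $\displaystyle |V(G)\setminus(Z_1\cup\dots\cup Z_r\cup L)|\le 64r^2\cdot\frac tc\cdot\Bigl(\frac{e}{8\zeta}\Bigr)^t$, where $e$ is the base of the natural logarithm. 2. For every $i\in\{1,\dots,r\}$, the graph $G'[Z_i]$ has average degree at least $d-\eta|Z_i|$. 3. For every $i\in\{1,\dots,r\}$, the graph $G'[Z_i]$ has no $\zeta$-sparse cuts. 4. For every $i\in\{1,\dots,r\}$, the graph $G'[Z_i]$ is either bipartite and balanced, or at least $\gamma n^2$ edges have to be removed from it to make it bipartite. 5. $G[L]$ has a perfect $K_{t,t}$-packing. -/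

import Mathlib

namespace DenseRegular

/-- The functions that calibrate a hierarchy of constants `a ≪ b`: non-decreasing maps
`(0, 1] → (0, 1]`. The values outside `(0, 1]` play no role. -/
structure IsHierarchyFunction (f : ℝ → ℝ) : Prop where
  mapsTo : Set.MapsTo f (Set.Ioc 0 1) (Set.Ioc 0 1)
  monotoneOn : MonotoneOn f (Set.Ioc 0 1)

variable {V : Type*}

open Classical in
/-- The average degree of a (non-empty) finite graph. -/
noncomputable def averageDegree [Fintype V] (G : SimpleGraph V) : ℝ :=
  (∑ v, (G.degree v : ℝ)) / Fintype.card V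

open Classical in
/-- The cut `{X, V ∖ X}` (both sides non-empty) is `α`-sparse if it is crossed by at most
`α |X| |V ∖ X|` edges. -/
def IsSparseCut [Fintype V] (G : SimpleGraph V) (α : ℝ) (X : Finset V) : Prop :=
  X.Nonempty ∧ Xᶜ.Nonempty ∧
    ((G.interedges X Xᶜ).card : ℝ) ≤ α * (X.card : ℝ) * (Xᶜ.card : ℝ)

/-- `G` has no `α`-sparse cuts. -/
def NoSparseCuts [Fintype V] (G : SimpleGraph V) (α : ℝ) : Prop :=
  ∀ X : Finset V, ¬ IsSparseCut G α X

/-- `G` is bipartite and balanced: its vertex set is the disjoint union of two independent sets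
of the same size. -/
def IsBalancedBipartite (G : SimpleGraph V) : Prop :=
  ∃ X Y : Set V, G.IsBipartiteWith X Y ∧ X ∪ Y = Set.univ ∧ X.ncard = Y.ncard

/-- At least `m` edges have to be removed from `G` to make it bipartite. -/
def IsFarFromBipartite (G : SimpleGraph V) (m : ℝ) : Prop :=
  ∀ E : Set (Sym2 V), E ⊆ G.edgeSet → (G.deleteEdges E).IsBipartite → m ≤ (E.ncard : ℝ)

/-- `G` has a perfect `H`-packing: a collection of pairwise vertex-disjoint subgraphs of `G`, each
isomorphic to `H`, covering all vertices of `G`. -/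
def HasPerfectPacking {W : Type*} (H : SimpleGraph W) (G : SimpleGraph V) : Prop :=
  ∃ 𝒦 : Set G.Subgraph,
    (∀ K ∈ 𝒦, Nonempty (K.coe ≃g H)) ∧
    𝒦.PairwiseDisjoint SimpleGraph.Subgraph.verts ∧
    (⋃ K ∈ 𝒦, K.verts) = Set.univ

end DenseRegular

/-! The proof has two halves: a decomposition into clusters, and a repair of the imbalance of the
bipartite ones.

Decomposition. A `Labelling` sorts the vertices into clusters and, in marked clusters, into two
sides. It is good if few edges are wrong and every vertex keeps linearly many right edges. Starting
from one unmarked cluster, a sparse cut is used to split a cluster (`IsGood.exists_split`), and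
closeness to bipartite is used to mark it (`IsGood.exists_mark`). In both cases
`exists_majority_colouring` moves a few vertices so that right degrees stay linear. Since `G` is
regular, a cluster with few wrong edges has almost `d` vertices or more, so there are at most
`⌈1/c⌉` clusters (`IsGood.card_indices_le`). The potential is then at most `2⌈1/c⌉`, and refinement
stops after boundedly many steps. `exists_isTerminal` fixes the scales backwards, by the number of
steps still available.

Balance. In a marked cluster the right edges have as many ends on one side as on the other. By
regularity, `d` times the difference of the side sizes is therefore the signed number of ends of
wrong edges in the cluster. Consider a `K_{t,t}` made of a vertex `v`, `t` wrong neighbours of `v`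
with one label, and `t - 1` common right neighbours of these leaves. Its leaves and common
neighbours cancel except for one leaf, so in every marked cluster its signed size is that of the two
ends of a single wrong edge. Removing about one such gadget per `d` wrong edges hence cancels all
imbalances at once, up to a bounded rounding error that is trimmed away.

The difficulty is to place all gadgets disjointly (`IsCalibrated.exists_gadgetUnion`). Vertices are
grouped by label and by the labels in which they have many wrong neighbours. Edges between two
groups are attributed to the end that sees many of them. Such a group cannot run out of centres,
because wrong degrees are at most `(1 - δ) d`. Edges with few wrong neighbours at both ends are
spread out, so a small used set cannot block them.

The number of trimmed vertices depends only on `c` and `t`, so it is below the required bound once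
`ζ` is small. -/

namespace DenseRegular

open Finset
open scoped Classical

/-! ### Labellings, right and wrong edges, and majority recolouring -/

section Labelling

variable {V : Type*} [Fintype V] {ι : Type*}

/-- The number of neighbours of `v` in `H`. -/
noncomputable def deg (H : SimpleGraph V) (v : V) : ℕ := #{u | H.Adj v u}

/-- A division of the vertices into clusters, some of which are marked as bipartite and then
have two sides. -/
structure Labelling (V ι : Type*) where
  /-- The cluster of a vertex. -/
  cl : V → ι
  /-- The side of a vertex in its cluster, which only matters in bipartite clusters. -/
  side : V → Bool
  /-- The clusters marked as bipartite. -/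
  bip : Set ι

namespace Labelling

/-- The edges that respect the labelling: they lie in a cluster and cross its sides if the
cluster is marked as bipartite. -/
def right (S : Labelling V ι) (G : SimpleGraph V) : SimpleGraph V where
  Adj u v := G.Adj u v ∧ S.cl u = S.cl v ∧ (S.cl u ∈ S.bip → S.side u ≠ S.side v)
  symm := ⟨fun _ _ h => ⟨h.1.symm, h.2.1.symm, fun hb => (h.2.2 (h.2.1 ▸ hb)).symm⟩⟩
  loopless := ⟨fun v h => G.loopless.irrefl v h.1⟩

/-- The edges that do not respect the labelling. -/
def wrong (S : Labelling V ι) (G : SimpleGraph V) : SimpleGraph V := G \ S.right G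

/-- The vertex set of a cluster. -/
noncomputable def cluster (S : Labelling V ι) (i : ι) : Finset V := {v | S.cl v = i}

/-- The indices of the non-empty clusters. -/
noncomputable def indices (S : Labelling V ι) : Finset ι := univ.image S.cl

/-- The number of clusters, those marked as bipartite counting twice. -/
noncomputable def potential (S : Labelling V ι) : ℕ :=
  #S.indices + #{i ∈ S.indices | i ∈ S.bip}

/-- There are few wrong edges, and all right degrees are linear. -/
structure IsGood (S : Labelling V ι) (G : SimpleGraph V) (η δ : ℝ) : Prop where
  wrong_le : (∑ v, (deg (S.wrong G) v : ℝ)) ≤ η * (Fintype.card V : ℝ) ^ 2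
  le_right : ∀ v, δ * (Fintype.card V : ℝ) ≤ deg (S.right G) v

lemma mem_cluster {S : Labelling V ι} {i : ι} {v : V} : v ∈ S.cluster i ↔ S.cl v = i := by
  simp [cluster]

lemma mem_indices {S : Labelling V ι} {i : ι} : i ∈ S.indices ↔ ∃ v, S.cl v = i := by
  simp [indices]

lemma deg_add_deg (S : Labelling V ι) (G : SimpleGraph V) (v : V) :
    deg (S.right G) v + deg (S.wrong G) v = deg G v := by
  unfold deg
  rw [← card_union_of_disjoint]
  · congr 1
    ext u
    simp only [mem_union, mem_filter, mem_univ, true_and, wrong, SimpleGraph.sdiff_adj]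
    constructor
    · rintro (h | h)
      · exact h.1
      · exact h.1
    · intro h
      by_cases hr : (S.right G).Adj v u
      · exact Or.inl hr
      · exact Or.inr ⟨h, hr⟩
  · rw [disjoint_left]
    intro u hu hu'
    simp only [mem_filter, mem_univ, true_and, wrong, SimpleGraph.sdiff_adj] at hu hu'
    exact hu'.2 hu

end Labelling

/-- A two-colouring with few bad edges can be changed at few vertices so that each vertex sees
many good edges. -/
lemma exists_majority_colouring (H : SimpleGraph V) (x : Bool) (s : V → Bool) (Z : Finset V)
    {δ β : ℝ} (hδ : 0 < δ) (hV : 0 < Fintype.card V) (hβ : 8 * β ≤ δ ^ 2)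
    (hdeg : ∀ v ∈ Z, δ * (Fintype.card V : ℝ) ≤ deg H v)
    (hZ : ∀ v ∈ Z, ∀ u, H.Adj v u → u ∈ Z)
    (hbad : (∑ v ∈ Z, (#{u | H.Adj v u ∧ xor (s v) (s u) ≠ x} : ℝ)) ≤
      β * (Fintype.card V : ℝ) ^ 2) :
    ∃ s' : V → Bool,
      (∀ v ∈ Z, δ / 4 * (Fintype.card V : ℝ) ≤ #{u | H.Adj v u ∧ xor (s' v) (s' u) = x}) ∧
      (#{v ∈ Z | s' v ≠ s v} : ℝ) ≤ δ / 4 * (Fintype.card V : ℝ) ∧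
      (∑ v ∈ Z, (#{u | H.Adj v u ∧ xor (s' v) (s' u) ≠ x} : ℝ)) ≤
        (β + 4 * β / δ) * (Fintype.card V : ℝ) ^ 2 := by
  set n : ℝ := (Fintype.card V : ℝ) with hn
  have hn0 : 0 < n := by rw [hn]; exact_mod_cast hV
  let bad : V → Finset V := fun v => {u | H.Adj v u ∧ xor (s v) (s u) ≠ x}
  let good : V → Finset V := fun v => {u | H.Adj v u ∧ xor (s v) (s u) = x}
  have hsplit : ∀ v, #(good v) + #(bad v) = deg H v := by
    intro v
    have := card_filter_add_card_filter_not (s := ({u | H.Adj v u} : Finset V))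
      (fun u => xor (s v) (s u) = x)
    simpa only [good, bad, filter_filter, deg] using this
  -- All vertices with more bad than good neighbours flip simultaneously, judged by the old
  -- colouring.
  obtain ⟨s', hs₁, hs₂⟩ : ∃ s' : V → Bool,
      (∀ v, v ∈ Z ∧ deg H v < 2 * #(bad v) → s' v = !(s v)) ∧
      ∀ v, ¬ (v ∈ Z ∧ deg H v < 2 * #(bad v)) → s' v = s v :=
    ⟨fun v => if v ∈ Z ∧ deg H v < 2 * #(bad v) then !(s v) else s v,
      fun v hv => if_pos hv, fun v hv => if_neg hv⟩
  obtain ⟨ch, hchdef⟩ : ∃ ch : Finset V, ch = {v ∈ Z | s' v ≠ s v} := ⟨_, rfl⟩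
  have hch : ∀ v, v ∈ ch → v ∈ Z ∧ deg H v < 2 * #(bad v) := by
    intro v hv
    by_contra hcon
    rw [hchdef] at hv
    exact (mem_filter.1 hv).2 (hs₂ v hcon)
  have hchZ : ∀ v ∈ Z, v ∉ ch → s' v = s v := by
    intro v hv hvc
    by_contra hne
    exact hvc (hchdef ▸ mem_filter.2 ⟨hv, hne⟩)
  -- A flipped vertex has more than `δn/2` bad neighbours, so few vertices flip.
  have hchcard : (#ch : ℝ) * (δ * n) ≤ 2 * (β * n ^ 2) := by
    calc (#ch : ℝ) * (δ * n) = ∑ v ∈ ch, δ * n := by simp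
      _ ≤ ∑ v ∈ ch, 2 * (#(bad v) : ℝ) := by
        apply sum_le_sum
        intro v hv
        have h1 := hdeg v (hch v hv).1
        have h2 : (deg H v : ℝ) < 2 * #(bad v) := by exact_mod_cast (hch v hv).2
        linarith
      _ = 2 * ∑ v ∈ ch, (#(bad v) : ℝ) := by rw [mul_sum]
      _ ≤ 2 * ∑ v ∈ Z, (#(bad v) : ℝ) := by
        gcongr
        exact fun v hv => (hch v hv).1
      _ ≤ 2 * (β * n ^ 2) := by gcongr
  have hch2 : (#ch : ℝ) ≤ 2 * β / δ * n := by
    rw [div_mul_eq_mul_div, le_div_iff₀ hδ]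
    nlinarith
  have hβδ : 2 * β / δ ≤ δ / 4 := by
    rw [div_le_div_iff₀ hδ (by norm_num)]
    nlinarith
  have hch3 : (#ch : ℝ) ≤ δ / 4 * n := hch2.trans (by gcongr)
  refine ⟨s', ?_, hchdef ▸ hch3, ?_⟩
  · intro v hv
    -- neighbours that are good for the new colour of `v` and the old colouring
    let g : Finset V := {u | H.Adj v u ∧ xor (s' v) (s u) = x}
    have hg : deg H v ≤ 2 * #g := by
      have h0 := hsplit v
      by_cases h : deg H v < 2 * #(bad v)
      · have : g = bad v := by
          have hs' : s' v = !(s v) := hs₁ v ⟨hv, h⟩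
          simp only [g, bad, hs']
          ext u
          simp only [mem_filter, mem_univ, true_and]
          cases s v <;> cases s u <;> cases x <;> simp
        rw [this]; exact h.le
      · have : g = good v := by
          have hs' : s' v = s v := hs₂ v (fun h' => h h'.2)
          simp only [g, good, hs']
        rw [this]; omega
    -- At least half the neighbours are good for the new colour of `v`. Only flipped ones can spoil
    -- this, and there are at most `δn/4`, which leaves `δn/2 - δn/4`.
    have hsub : g \ ch ⊆ ({u | H.Adj v u ∧ xor (s' v) (s' u) = x} : Finset V) := by
      intro u hu
      simp only [g, mem_sdiff, mem_filter, mem_univ, true_and] at hu ⊢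
      refine ⟨hu.1.1, ?_⟩
      rw [hchZ u (hZ v hv u hu.1.1) hu.2]
      exact hu.1.2
    have h1 : #g ≤ #({u | H.Adj v u ∧ xor (s' v) (s' u) = x} : Finset V) + #ch := by
      have := card_le_card hsub
      have := le_card_sdiff ch g
      omega
    have h2 : (#g : ℝ) ≤ #({u | H.Adj v u ∧ xor (s' v) (s' u) = x} : Finset V) + #ch := by
      exact_mod_cast h1
    have h3 : (deg H v : ℝ) ≤ 2 * #g := by exact_mod_cast hg
    have h4 := hdeg v hv
    linarith
  -- A flipped vertex may have up to `n` bad neighbours, while any other vertex gains at most the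
  -- flipped ones. Summing costs `2n` per flip.
  · have key : ∀ v ∈ Z, (#{u | H.Adj v u ∧ xor (s' v) (s' u) ≠ x} : ℝ) ≤
        #(bad v) + (if v ∈ ch then n else 0) + #ch := by
      intro v hv
      by_cases hvc : v ∈ ch
      · rw [if_pos hvc]
        have : (#{u | H.Adj v u ∧ xor (s' v) (s' u) ≠ x} : ℝ) ≤ n := by
          rw [hn]; exact_mod_cast card_le_univ _
        have h1 : (0 : ℝ) ≤ #(bad v) := by positivity
        have h2 : (0 : ℝ) ≤ #ch := by positivity
        linarith
      · rw [if_neg hvc, add_zero]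
        have : ({u | H.Adj v u ∧ xor (s' v) (s' u) ≠ x} : Finset V) ⊆ bad v ∪ ch := by
          intro u hu
          replace hu := (mem_filter.1 hu).2
          by_cases huc : u ∈ ch
          · exact mem_union_right _ huc
          · refine mem_union_left _ (mem_filter.2 ⟨mem_univ _, hu.1, ?_⟩)
            rw [← hchZ u (hZ v hv u hu.1) huc, ← hchZ v hv hvc]
            exact hu.2
        exact_mod_cast (card_le_card this).trans (card_union_le _ _)
    calc (∑ v ∈ Z, (#{u | H.Adj v u ∧ xor (s' v) (s' u) ≠ x} : ℝ))
        ≤ ∑ v ∈ Z, ((#(bad v) : ℝ) + (if v ∈ ch then n else 0) + #ch) := sum_le_sum key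
      _ = ∑ v ∈ Z, (#(bad v) : ℝ) + ∑ v ∈ Z, (if v ∈ ch then n else 0) + #Z * #ch := by
        rw [sum_add_distrib, sum_add_distrib]; simp
      _ ≤ β * n ^ 2 + #ch * n + n * #ch := by
        have h1 : ∑ v ∈ Z, (if v ∈ ch then n else 0) = #ch * n := by
          rw [← sum_filter]
          have : Z.filter (· ∈ ch) = ch := by
            ext v; simp only [mem_filter]
            exact ⟨fun h => h.2, fun h => ⟨(hch v h).1, h⟩⟩
          rw [this]; simp
        have h2 : (#Z : ℝ) ≤ n := by rw [hn]; exact_mod_cast card_le_univ _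
        rw [h1]
        gcongr
      _ ≤ (β + 4 * β / δ) * n ^ 2 := by
        have : (#ch : ℝ) * n ≤ 2 * β / δ * n * n := by gcongr
        have e : 4 * β / δ = 2 * (2 * β / δ) := by ring
        rw [e]
        nlinarith

end Labelling

/-! ### Counting edges between sets, and sparse cuts of induced subgraphs -/

section Cuts

variable {V : Type*}

/-- The number of pairs in `A × B` that are adjacent in `H`. -/
noncomputable def cut (H : SimpleGraph V) (A B : Finset V) : ℕ :=
  #{p ∈ A ×ˢ B | H.Adj p.1 p.2}

lemma cut_eq_sum (H : SimpleGraph V) (A B : Finset V) :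
    cut H A B = ∑ v ∈ A, #{u ∈ B | H.Adj v u} := by
  unfold cut
  rw [card_filter, sum_product]
  simp_rw [card_filter]

lemma cut_comm (H : SimpleGraph V) (A B : Finset V) : cut H A B = cut H B A := by
  rw [cut_eq_sum, cut_eq_sum]
  simp_rw [card_filter]
  rw [sum_comm]
  simp_rw [H.adj_comm]

lemma cut_le_card_mul_card (H : SimpleGraph V) (A B : Finset V) : cut H A B ≤ #A * #B := by
  unfold cut
  exact (card_filter_le _ _).trans (card_product _ _).le

lemma cut_mono (H : SimpleGraph V) {A A' B B' : Finset V} (hA : A ⊆ A') (hB : B ⊆ B') :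
    cut H A B ≤ cut H A' B' :=
  card_le_card (filter_subset_filter _ (product_subset_product hA hB))

lemma cut_union_right_le (H : SimpleGraph V) (A B C : Finset V) :
    cut H A (B ∪ C) ≤ cut H A B + cut H A C := by
  unfold cut
  rw [product_union, filter_union]
  exact card_union_le _ _

lemma isSparseCut_iff [Fintype V] [DecidableEq V] (H : SimpleGraph V) [DecidableRel H.Adj]
    (α : ℝ) (X : Finset V) :
    IsSparseCut H α X ↔ X.Nonempty ∧ Xᶜ.Nonempty ∧
      (#(H.interedges X Xᶜ) : ℝ) ≤ α * (#X : ℝ) * (#Xᶜ : ℝ) := by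
  unfold IsSparseCut
  congr!

/-- Sparse cuts of an induced subgraph in terms of the ambient graph. -/
lemma noSparseCuts_induce_iff (H : SimpleGraph V) (Z : Finset V) (α : ℝ) :
    NoSparseCuts (H.induce (Z : Set V)) α ↔
      ∀ X ⊆ Z, X.Nonempty → (Z \ X).Nonempty →
        α * (#X : ℝ) * (#(Z \ X) : ℝ) < cut H X (Z \ X) := by
  have hcompl : ∀ X : Finset (Z : Set V),
      Xᶜ.map (Function.Embedding.subtype _) = Z \ X.map (Function.Embedding.subtype _) := by
    intro X
    ext v
    simp only [mem_map, mem_compl, Function.Embedding.subtype_apply, mem_sdiff, Subtype.exists,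
      exists_and_right, exists_eq_right]
    constructor
    · rintro ⟨h, h'⟩
      exact ⟨by simpa using h, fun ⟨_, h2⟩ => h' h2⟩
    · rintro ⟨h, h'⟩
      exact ⟨by simpa using h, fun h2 => h' ⟨by simpa using h, h2⟩⟩
  have hinter : ∀ X Y : Finset (Z : Set V), #((H.induce (Z : Set V)).interedges X Y) =
      cut H (X.map (Function.Embedding.subtype _)) (Y.map (Function.Embedding.subtype _)) := by
    intro X Y
    unfold cut SimpleGraph.interedges Rel.interedges
    refine card_bij (fun p _ => (p.1.1, p.2.1)) ?_ ?_ ?_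
    · rintro ⟨a, b⟩ h
      simp only [mem_filter, mem_product, SimpleGraph.comap_adj] at h ⊢
      exact ⟨⟨mem_map_of_mem _ h.1.1, mem_map_of_mem _ h.1.2⟩, h.2⟩
    · rintro ⟨a, b⟩ _ ⟨a', b'⟩ _ h
      simp only [Prod.mk.injEq] at h
      exact Prod.ext (Subtype.ext h.1) (Subtype.ext h.2)
    · rintro ⟨a, b⟩ h
      simp only [mem_filter, mem_product, mem_map] at h
      obtain ⟨⟨⟨a', ha', rfl⟩, ⟨b', hb', rfl⟩⟩, hab⟩ := h
      exact ⟨(a', b'), by simpa [ha', hb'] using hab, rfl⟩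
  constructor
  · intro h X hX hX1 hX2
    have hmap : (X.subtype (· ∈ (Z : Set V))).map (Function.Embedding.subtype _) = X := by
      rw [subtype_map]
      exact filter_true_of_mem (fun v hv => hX hv)
    have h1 := h (X.subtype (· ∈ (Z : Set V)))
    rw [isSparseCut_iff] at h1
    have hc := hcompl (X.subtype (· ∈ (Z : Set V)))
    have hi := hinter (X.subtype (· ∈ (Z : Set V))) (X.subtype (· ∈ (Z : Set V)))ᶜ
    rw [hmap] at hc
    rw [hmap, hc] at hi
    have hcard1 : #(X.subtype (· ∈ (Z : Set V))) = #X := by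
      conv_rhs => rw [← hmap]
      rw [card_map]
    have hcard2 : #(X.subtype (· ∈ (Z : Set V)))ᶜ = #(Z \ X) := by
      rw [← hc, card_map]
    by_contra hcon
    apply h1
    refine ⟨?_, ?_, ?_⟩
    · rw [← card_pos, hcard1, card_pos]; exact hX1
    · rw [← card_pos, hcard2, card_pos]; exact hX2
    · rw [hcard1, hcard2]
      rw [hi]
      exact not_lt.1 hcon
  · intro h X hX
    rw [isSparseCut_iff] at hX
    obtain ⟨hX1, hX2, hX3⟩ := hX
    have hX4 := h (X.map (Function.Embedding.subtype _)) ?_ (hX1.map) ?_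
    · rw [← hcompl, card_map, card_map, ← hinter] at hX4
      exact absurd hX4 (not_lt.2 hX3)
    · intro v hv
      obtain ⟨a, _, rfl⟩ := mem_map.1 hv
      exact a.2
    · rw [← hcompl]; exact hX2.map

end Cuts

/-! ### Refinement steps: splitting a cluster and marking it as bipartite -/

namespace Labelling

variable {V : Type*} [Fintype V] {ι : Type*}

/-- A labelling stays good if in one cluster only the edges that are good for a two-colouring
are kept. -/
lemma IsGood.of_colouring {S S' : Labelling V ι} {G : SimpleGraph V} {η δ β : ℝ}
    (hS : S.IsGood G η δ) (hδ : 0 < δ) (x : Bool) (s : V → Bool) (Z : Finset V)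
    (hright : ∀ u v, (S'.right G).Adj u v ↔
      (S.right G).Adj u v ∧ (u ∈ Z → xor (s u) (s v) = x))
    (hgood : ∀ v ∈ Z, δ / 4 * (Fintype.card V : ℝ) ≤
      #{u | (S.right G).Adj v u ∧ xor (s v) (s u) = x})
    (hbad : (∑ v ∈ Z, (#{u | (S.right G).Adj v u ∧ xor (s v) (s u) ≠ x} : ℝ)) ≤
      β * (Fintype.card V : ℝ) ^ 2) :
    S'.IsGood G (η + β) (δ / 4) := by
  have hout : ∀ v ∉ Z, deg (S'.right G) v = deg (S.right G) v := by
    intro v hv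
    unfold deg
    congr 1
    ext u
    simp [hright, hv]
  have hin : ∀ v ∈ Z, deg (S'.right G) v = #{u | (S.right G).Adj v u ∧ xor (s v) (s u) = x} := by
    intro v hv
    unfold deg
    congr 1
    ext u
    simp [hright, hv]
  refine ⟨?_, ?_⟩
  · have key : ∀ v, (deg (S'.wrong G) v : ℝ) = deg (S.wrong G) v +
        if v ∈ Z then (#{u | (S.right G).Adj v u ∧ xor (s v) (s u) ≠ x} : ℝ) else 0 := by
      intro v
      have h1 := S.deg_add_deg G v
      have h2 := S'.deg_add_deg G v
      by_cases hv : v ∈ Z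
      · rw [if_pos hv]
        rw [hin v hv] at h2
        have := card_filter_add_card_filter_not (s := ({u | (S.right G).Adj v u} : Finset V))
          (fun u => xor (s v) (s u) = x)
        rw [filter_filter, filter_filter] at this
        have h3 : #{u | (S.right G).Adj v u ∧ xor (s v) (s u) = x} +
          #{u | (S.right G).Adj v u ∧ xor (s v) (s u) ≠ x} = deg (S.right G) v := this
        have h4 : deg (S'.wrong G) v = deg (S.wrong G) v +
          #{u | (S.right G).Adj v u ∧ xor (s v) (s u) ≠ x} := by omega
        exact_mod_cast h4
      · rw [if_neg hv, add_zero]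
        rw [hout v hv] at h2
        have : deg (S'.wrong G) v = deg (S.wrong G) v := by omega
        exact_mod_cast this
    simp_rw [key]
    rw [sum_add_distrib, add_mul, ← sum_filter, filter_mem_eq_inter, univ_inter]
    exact add_le_add hS.wrong_le hbad
  · intro v
    by_cases hv : v ∈ Z
    · rw [hin v hv]; exact hgood v hv
    · rw [hout v hv]
      refine le_trans ?_ (hS.le_right v)
      gcongr
      linarith

lemma cluster_closed (S : Labelling V ι) (G : SimpleGraph V) (i : ι) :
    ∀ v ∈ S.cluster i, ∀ u, (S.right G).Adj v u → u ∈ S.cluster i := by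
  intro v hv u h
  rw [mem_cluster] at hv ⊢
  rw [← h.2.1, hv]

/-- A cluster with a sparse cut can be split. -/
lemma IsGood.exists_split {S : Labelling V ι} {G : SimpleGraph V} {η δ α : ℝ}
    (hS : S.IsGood G η δ) (hV : 0 < Fintype.card V) (hδ : 0 < δ) (hδ1 : δ ≤ 1) (hα : 0 < α)
    (hαδ : 16 * α ≤ δ ^ 2) {i i' : ι} (hi : i ∈ S.indices) (hi' : i' ∉ S.indices)
    (hcut : ¬ NoSparseCuts ((S.right G).induce (S.cluster i : Set V)) α) :
    ∃ S' : Labelling V ι, S'.IsGood G (η + (2 * α + 8 * α / δ)) (δ / 4) ∧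
      S.potential + 1 ≤ S'.potential := by
  set n : ℝ := (Fintype.card V : ℝ) with hn
  have hn0 : 0 < n := by rw [hn]; exact_mod_cast hV
  rw [noSparseCuts_induce_iff] at hcut
  push Not at hcut
  obtain ⟨X, hXZ, hX, hY, hXY⟩ := hcut
  set Z := S.cluster i with hZdef
  set Y := Z \ X with hYdef
  have hclosed := S.cluster_closed G i
  have hcardn : ∀ A : Finset V, (#A : ℝ) ≤ n := fun A => by
    rw [hn]; exact_mod_cast card_le_univ _
  have hαδ' : α ≤ δ / 2 := by nlinarith
  have hXY2 : (cut (S.right G) X Y : ℝ) ≤ α * n ^ 2 := by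
    refine hXY.trans ?_
    calc α * (#X : ℝ) * #Y ≤ α * n * n := by gcongr <;> exact hcardn _
      _ = α * n ^ 2 := by ring
  -- both sides of the cut are large
  have hlarge : ∀ A B : Finset V, A.Nonempty → A ∪ B = Z →
      (cut (S.right G) A B : ℝ) ≤ α * #A * #B → δ / 2 * n ≤ #A := by
    intro A B hA hAB hc
    have hA0 : (0 : ℝ) < #A := by exact_mod_cast hA.card_pos
    have h1 : (#A : ℝ) * (δ * n) ≤ cut (S.right G) A Z := by
      rw [cut_eq_sum]
      push_cast
      calc (#A : ℝ) * (δ * n) = ∑ v ∈ A, δ * n := by simp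
        _ ≤ _ := by
          apply sum_le_sum
          intro v hv
          refine (hS.le_right v).trans ?_
          have : ({u | (S.right G).Adj v u} : Finset V) ⊆ ({u ∈ Z | (S.right G).Adj v u}) := by
            intro u hu
            rw [mem_filter] at hu ⊢
            exact ⟨hclosed v (by rw [← hZdef, ← hAB]; exact mem_union_left _ hv) u hu.2, hu.2⟩
          exact_mod_cast card_le_card this
    have h2 : (cut (S.right G) A Z : ℝ) ≤ cut (S.right G) A A + cut (S.right G) A B := by
      rw [← hAB]
      exact_mod_cast cut_union_right_le _ _ _ _
    have h3 : (cut (S.right G) A A : ℝ) ≤ #A * #A := by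
      exact_mod_cast cut_le_card_mul_card _ _ _
    -- The right degrees from `A` stay in the cluster: at most `|A|` go to `A` itself and on average
    -- at most `αn` to the other side, with `α ≤ δ/2`.
    have h4 : (#A : ℝ) * (δ * n) ≤ #A * (#A + α * n) := by
      have : α * #A * #B ≤ α * #A * n := by gcongr; exact hcardn _
      nlinarith
    have h5 := le_of_mul_le_mul_left h4 hA0
    nlinarith
  have hXl : δ / 2 * n ≤ #X := hlarge X Y hX (union_sdiff_of_subset hXZ) hXY
  have hYl : δ / 2 * n ≤ #Y := by
    refine hlarge Y X hY (sdiff_union_of_subset hXZ) ?_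
    rw [cut_comm]
    linarith
  -- Colour by the side of the cut, so the bad edges are those crossing it. They are counted from
  -- both ends, hence `β = 2α`.
  obtain ⟨s, hs1, hs2, hs3⟩ := exists_majority_colouring (S.right G) false
    (fun v => decide (v ∈ X)) Z (β := 2 * α) hδ hV (by linarith) (fun v _ => hS.le_right v)
    hclosed (by
      calc _ = ∑ v ∈ X, (#{u | (S.right G).Adj v u ∧
              xor (decide (v ∈ X)) (decide (u ∈ X)) ≠ false} : ℝ) +
            ∑ v ∈ Y, (#{u | (S.right G).Adj v u ∧
              xor (decide (v ∈ X)) (decide (u ∈ X)) ≠ false} : ℝ) := by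
            rw [add_comm, sum_sdiff hXZ]
        _ ≤ (cut (S.right G) X Y : ℝ) + cut (S.right G) Y X := by
          rw [cut_eq_sum, cut_eq_sum]
          push_cast
          gcongr with v hv v hv
          · intro u hu
            rw [mem_filter] at hu ⊢
            have hu' : u ∉ X := by simpa [hv] using hu.2.2
            exact ⟨mem_sdiff.2 ⟨hclosed v (hXZ hv) u hu.2.1, hu'⟩, hu.2.1⟩
          · intro u hu
            rw [mem_filter] at hu ⊢
            rw [mem_sdiff] at hv
            have hu' : u ∈ X := by simpa [hv.2] using hu.2.2
            exact ⟨hu', hu.2.1⟩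
        _ ≤ 2 * α * n ^ 2 := by
          rw [cut_comm (S.right G) Y X]
          linarith)
  have hii' : i ≠ i' := fun h => hi' (h ▸ hi)
  have hcl : ∀ v, S.cl v ≠ i' := fun v h => hi' (mem_indices.2 ⟨v, h⟩)
  -- The part of colour `false` moves to the fresh index `i'`, which inherits the mark of `i`; the
  -- sides stay as they are.
  obtain ⟨S', hcl', hside', hbip'⟩ : ∃ S' : Labelling V ι,
      (∀ v, S'.cl v = if v ∈ Z ∧ s v = false then i' else S.cl v) ∧ S'.side = S.side ∧
      ∀ j, j ∈ S'.bip ↔ (j = i' ∧ i ∈ S.bip) ∨ (j ≠ i' ∧ j ∈ S.bip) :=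
    ⟨{ cl := fun v => if v ∈ Z ∧ s v = false then i' else S.cl v
       side := S.side
       bip := {j | (j = i' ∧ i ∈ S.bip) ∨ (j ≠ i' ∧ j ∈ S.bip)} },
      fun _ => rfl, rfl, fun _ => Iff.rfl⟩
  have hZi : ∀ v, v ∈ Z ↔ S.cl v = i := fun v => mem_cluster
  have hbipcl : ∀ v, S'.cl v ∈ S'.bip ↔ S.cl v ∈ S.bip := by
    intro v
    rw [hbip', hcl']
    split_ifs with h
    · have := (hZi v).1 h.1
      simp [this]
    · simp [hcl v]
  refine ⟨S', ?_, ?_⟩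
  · have e : η + (2 * α + 8 * α / δ) = η + (2 * α + 4 * (2 * α) / δ) := by ring
    rw [e]
    refine hS.of_colouring hδ false s Z ?_ hs1 hs3
    intro u v
    have hcleq : S'.cl u = S'.cl v ↔ S.cl u = S.cl v ∧ (u ∈ Z → xor (s u) (s v) = false) := by
      rw [hcl', hcl']
      by_cases hu : u ∈ Z <;> by_cases hv : v ∈ Z
      · have h1 := (hZi u).1 hu
        have h2 := (hZi v).1 hv
        cases hsu : s u <;> cases hsv : s v <;> simp [hu, hv, h1, h2, hii', hii'.symm]
      · have h1 := (hZi u).1 hu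
        have h2 : S.cl v ≠ i := fun h => hv ((hZi v).2 h)
        have h3 := (hcl v).symm
        simp only [hu, hv, h1, true_and, false_and, if_false]
        split_ifs
        · simp [h3, h2.symm]
        · simp [h2.symm]
      · have h1 : S.cl u ≠ i := fun h => hu ((hZi u).2 h)
        have h2 := (hZi v).1 hv
        have h3 := (hcl u)
        simp only [hu, hv, h2, true_and, false_and, if_false, false_imp_iff, and_true]
        split_ifs
        · simp [h3, h1]
        · simp
      · simp [hu, hv]
    show (G.Adj u v ∧ S'.cl u = S'.cl v ∧ (S'.cl u ∈ S'.bip → S'.side u ≠ S'.side v)) ↔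
      (G.Adj u v ∧ S.cl u = S.cl v ∧ (S.cl u ∈ S.bip → S.side u ≠ S.side v)) ∧ _
    rw [hbipcl, hcleq, hside']
    tauto
  · -- the old indices survive and a new one appears
    -- Each side has at least `δn/2` vertices and at most `δn/4` are recoloured, so both parts are
    -- non-empty.
    have hex : ∀ (A : Finset V) (b : Bool), A ⊆ Z → δ / 2 * n ≤ #A →
        (∀ v ∈ A, decide (v ∈ X) = b) → ∃ v ∈ Z, s v = b := by
      intro A b hAZ hA hAb
      by_contra hcon
      push Not at hcon
      have : A ⊆ ({v ∈ Z | s v ≠ decide (v ∈ X)} : Finset V) := by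
        intro v hv
        rw [mem_filter]
        refine ⟨hAZ hv, ?_⟩
        rw [hAb v hv]
        exact hcon v (hAZ hv)
      have h1 : (#A : ℝ) ≤ #({v ∈ Z | s v ≠ decide (v ∈ X)} : Finset V) := by
        exact_mod_cast card_le_card this
      have h2 : 0 < δ * n := by positivity
      linarith
    obtain ⟨vX, hvX, hsX⟩ := hex X true hXZ hXl (fun v hv => by simp [hv])
    obtain ⟨vY, hvY, hsY⟩ := hex Y false sdiff_subset hYl (fun v hv => by
      simp [(mem_sdiff.1 hv).2])
    have hsub : insert i' S.indices ⊆ S'.indices := by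
      intro j hj
      rw [mem_insert] at hj
      rw [mem_indices]
      rcases hj with rfl | hj
      · exact ⟨vY, by rw [hcl', if_pos ⟨hvY, hsY⟩]⟩
      · obtain ⟨v, rfl⟩ := mem_indices.1 hj
        by_cases hv : v ∈ Z
        · refine ⟨vX, ?_⟩
          rw [hcl', if_neg (by simp [hsX]), (hZi v).1 hv, (hZi vX).1 hvX]
        · exact ⟨v, by rw [hcl', if_neg (by simp [hv])]⟩
    have h1 : #S.indices + 1 ≤ #S'.indices := by
      rw [← card_insert_of_notMem hi']
      exact card_le_card hsub
    have h2 : #{j ∈ S.indices | j ∈ S.bip} ≤ #{j ∈ S'.indices | j ∈ S'.bip} := by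
      apply card_le_card
      intro j hj
      rw [mem_filter] at hj ⊢
      refine ⟨hsub (mem_insert_of_mem hj.1), (hbip' j).2 (Or.inr ⟨?_, hj.2⟩)⟩
      rintro rfl
      exact hi' hj.1
    unfold potential
    omega

/-- A cluster that is close to bipartite can be marked as bipartite. -/
lemma IsGood.exists_mark {S : Labelling V ι} {G : SimpleGraph V} {η δ γ : ℝ}
    (hS : S.IsGood G η δ) (hV : 0 < Fintype.card V) (hδ : 0 < δ)
    (hγδ : 16 * γ ≤ δ ^ 2) {i : ι} (hi : i ∈ S.indices) (hib : i ∉ S.bip)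
    (hfar : ¬ IsFarFromBipartite ((S.right G).induce (S.cluster i : Set V))
      (γ * (Fintype.card V : ℝ) ^ 2)) :
    ∃ S' : Labelling V ι, S'.IsGood G (η + (2 * γ + 8 * γ / δ)) (δ / 4) ∧
      S.potential + 1 ≤ S'.potential := by
  set Z := S.cluster i with hZdef
  have hZi : ∀ v, v ∈ Z ↔ S.cl v = i := fun v => mem_cluster
  have hclosed := S.cluster_closed G i
  unfold IsFarFromBipartite at hfar
  push Not at hfar
  obtain ⟨E, -, ⟨φ⟩, hE⟩ := hfar
  let s : V → Bool := fun v => if h : v ∈ Z then decide (φ ⟨v, h⟩ = 0) else false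
  have hs : ∀ v (h : v ∈ Z), s v = decide (φ ⟨v, h⟩ = 0) := fun v h => dif_pos h
  -- The colouring is proper after deleting `E`, so every monochromatic right edge was deleted.
  have hmono : ∀ v u (hv : v ∈ Z) (hu : u ∈ Z), (S.right G).Adj v u → s v = s u →
      s((⟨v, hv⟩ : (Z : Set V)), ⟨u, hu⟩) ∈ E := by
    intro v u hv hu hvu hsvu
    by_contra hcon
    have hadj : (((S.right G).induce (Z : Set V)).deleteEdges E).Adj ⟨v, hv⟩ ⟨u, hu⟩ := by
      rw [SimpleGraph.deleteEdges_adj]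
      exact ⟨hvu, hcon⟩
    have h1 := φ.valid hadj
    rw [hs v hv, hs u hu] at hsvu
    apply h1
    have h2 : ∀ a b : Fin 2, decide (a = 0) = decide (b = 0) → a = b := by decide
    exact h2 _ _ hsvu
  have hbad : (∑ v ∈ Z, (#{u | (S.right G).Adj v u ∧ xor (s v) (s u) ≠ true} : ℝ)) ≤
      2 * γ * (Fintype.card V : ℝ) ^ 2 := by
    have h1 : ∑ v ∈ Z, #{u | (S.right G).Adj v u ∧ xor (s v) (s u) ≠ true} ≤ 2 * E.ncard := by
      let T : Finset (V × V) :=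
        {p | p.1 ∈ Z ∧ (S.right G).Adj p.1 p.2 ∧ xor (s p.1) (s p.2) ≠ true}
      have hT : ∑ v ∈ Z, #{u | (S.right G).Adj v u ∧ xor (s v) (s u) ≠ true} = #T := by
        simp only [T, card_filter, ← univ_product_univ, sum_product]
        rw [← sum_filter_add_sum_filter_not univ (· ∈ Z)]
        rw [sum_eq_zero (s := filter (fun v => ¬ v ∈ Z) univ), add_zero,
          filter_mem_eq_inter, univ_inter]
        · apply sum_congr rfl
          intro v hv
          simp [hv]
        · intro v hv
          simp [(mem_filter.1 hv).2]
      rw [hT]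
      have hTp : ∀ p ∈ T, ∃ (h1 : p.1 ∈ Z) (h2 : p.2 ∈ Z),
          s((⟨p.1, h1⟩ : (Z : Set V)), ⟨p.2, h2⟩) ∈ E := by
        intro p hp
        obtain ⟨hp1, hp2, hp3⟩ := (mem_filter.1 hp).2
        have hz := hclosed p.1 hp1 p.2 hp2
        refine ⟨hp1, hz, hmono _ _ hp1 hz hp2 ?_⟩
        revert hp3
        cases s p.1 <;> cases s p.2 <;> simp
      -- Each deleted edge comes from at most two ordered pairs. Outside the cluster `f` takes an
      -- arbitrary value, available because the cluster is non-empty.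
      let f : V × V → Sym2 (Z : Set V) := fun p =>
        if h : p.1 ∈ Z ∧ p.2 ∈ Z then s(⟨p.1, h.1⟩, ⟨p.2, h.2⟩)
        else s(⟨(mem_indices.1 hi).choose, (hZi _).2 (mem_indices.1 hi).choose_spec⟩,
          ⟨(mem_indices.1 hi).choose, (hZi _).2 (mem_indices.1 hi).choose_spec⟩)
      have hf : ∀ p (h1 : p.1 ∈ Z) (h2 : p.2 ∈ Z), f p = s(⟨p.1, h1⟩, ⟨p.2, h2⟩) :=
        fun p h1 h2 => dif_pos ⟨h1, h2⟩
      have hEfin : E.Finite := Set.toFinite E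
      have hcount : #T ≤ 2 * #hEfin.toFinset := by
        refine card_le_mul_card_image_of_maps_to (f := f) ?_ 2 ?_
        · intro p hp
          obtain ⟨h1, h2, h3⟩ := hTp p hp
          rw [hf p h1 h2]
          simpa using h3
        · intro e he
          by_cases hne : ∃ p ∈ T, f p = e
          · obtain ⟨p, hp, hpe⟩ := hne
            obtain ⟨h1, h2, _⟩ := hTp p hp
            have : ({q ∈ T | f q = e} : Finset (V × V)) ⊆ {p, (p.2, p.1)} := by
              intro q hq
              rw [mem_filter] at hq
              obtain ⟨g1, g2, _⟩ := hTp q hq.1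
              have h4 := hq.2
              rw [← hpe, hf p h1 h2, hf q g1 g2, Sym2.eq_iff] at h4
              simp only [Subtype.mk.injEq] at h4
              simp only [mem_insert, mem_singleton]
              rcases h4 with h4 | h4
              · exact Or.inl (Prod.ext h4.1 h4.2)
              · exact Or.inr (Prod.ext h4.1 h4.2)
            exact (card_le_card this).trans card_le_two
          · have : ({q ∈ T | f q = e} : Finset (V × V)) = ∅ := by
              rw [filter_eq_empty_iff]
              intro q hq hqe
              exact hne ⟨q, hq, hqe⟩
            rw [this]; simp
      rwa [Set.ncard_eq_toFinset_card E hEfin]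
    have h2 : (∑ v ∈ Z, (#{u | (S.right G).Adj v u ∧ xor (s v) (s u) ≠ true} : ℝ)) ≤
        2 * E.ncard := by exact_mod_cast h1
    linarith
  obtain ⟨s', hs1, -, hs3⟩ := exists_majority_colouring (S.right G) true s Z (β := 2 * γ) hδ hV
    (by linarith) (fun v _ => hS.le_right v) hclosed hbad
  obtain ⟨S', hcl', hside', hbip'⟩ : ∃ S' : Labelling V ι, S'.cl = S.cl ∧
      S'.side = (fun v => if v ∈ Z then s' v else S.side v) ∧ S'.bip = insert i S.bip :=
    ⟨{ cl := S.cl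
       side := fun v => if v ∈ Z then s' v else S.side v
       bip := insert i S.bip }, rfl, rfl, rfl⟩
  refine ⟨S', ?_, ?_⟩
  · have e : η + (2 * γ + 8 * γ / δ) = η + (2 * γ + 4 * (2 * γ) / δ) := by ring
    rw [e]
    refine hS.of_colouring hδ true s' Z ?_ hs1 hs3
    intro u v
    show (G.Adj u v ∧ S'.cl u = S'.cl v ∧ (S'.cl u ∈ S'.bip → S'.side u ≠ S'.side v)) ↔
      (G.Adj u v ∧ S.cl u = S.cl v ∧ (S.cl u ∈ S.bip → S.side u ≠ S.side v)) ∧ _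
    rw [hcl', hside', hbip', and_assoc, and_assoc]
    refine and_congr_right fun _ => and_congr_right fun huv => ?_
    by_cases hu : u ∈ Z
    · have hv : v ∈ Z := by rw [hZi] at hu ⊢; rw [← huv, hu]
      have h1 := (hZi u).1 hu
      simp only [if_pos hu, if_pos hv, h1]
      simp only [hib, Set.mem_insert_iff, true_or, hu, forall_true_left, false_imp_iff, true_and]
      cases s' u <;> cases s' v <;> simp
    · have hv : v ∉ Z := by rw [hZi] at hu ⊢; rw [← huv]; exact hu
      have h1 : S.cl u ≠ i := fun h => hu ((hZi u).2 h)
      simp [hu, hv, h1]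
  · have hind : S'.indices = S.indices := by rw [indices, indices, hcl']
    have h2 : #{j ∈ S.indices | j ∈ S.bip} + 1 ≤ #{j ∈ S'.indices | j ∈ S'.bip} := by
      rw [← card_insert_of_notMem (s := {j ∈ S.indices | j ∈ S.bip}) (a := i) (by simp [hib])]
      apply card_le_card
      intro j hj
      rw [mem_insert, mem_filter] at hj
      rw [mem_filter, hind, hbip']
      rcases hj with rfl | hj
      · exact ⟨hi, Set.mem_insert _ _⟩
      · exact ⟨hj.1, Set.mem_insert_of_mem _ hj.2⟩
    unfold potential
    rw [hind] at h2 ⊢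
    omega

end Labelling

/-! ### Termination of the refinement -/

namespace Labelling

section

variable {V : Type*} [Fintype V] {ι : Type*}

/-- No cluster has a `ζ`-sparse cut, and the clusters not marked as bipartite are far from being
bipartite. -/
def IsTerminal (S : Labelling V ι) (G : SimpleGraph V) (ζ γ : ℝ) : Prop :=
  ∀ i ∈ S.indices, NoSparseCuts ((S.right G).induce (S.cluster i : Set V)) ζ ∧
    (i ∈ S.bip ∨ IsFarFromBipartite ((S.right G).induce (S.cluster i : Set V))
      (γ * (Fintype.card V : ℝ) ^ 2))

lemma IsGood.mono {S : Labelling V ι} {G : SimpleGraph V} {η η' δ δ' : ℝ}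
    (hS : S.IsGood G η δ) (hη : η ≤ η') (hδ : δ' ≤ δ) : S.IsGood G η' δ' :=
  ⟨hS.wrong_le.trans (by gcongr), fun v => le_trans (by gcongr) (hS.le_right v)⟩

lemma deg_right_le_cluster (S : Labelling V ι) (G : SimpleGraph V) (v : V) :
    deg (S.right G) v ≤ #(S.cluster (S.cl v)) := by
  apply card_le_card
  intro u hu
  exact S.cluster_closed G _ v (mem_cluster.2 rfl) u (mem_filter.1 hu).2

/-- Right neighbours of a vertex lie in its own cluster, so a linear right degree forces a linear
cluster. -/
lemma IsGood.le_card_cluster {S : Labelling V ι} {G : SimpleGraph V} {η δ : ℝ}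
    (hS : S.IsGood G η δ) {i : ι} (hi : i ∈ S.indices) :
    δ * (Fintype.card V : ℝ) ≤ #(S.cluster i) := by
  obtain ⟨v, rfl⟩ := mem_indices.1 hi
  refine (hS.le_right v).trans ?_
  exact_mod_cast S.deg_right_le_cluster G v

/-- The number of clusters of a good labelling is at most `1 / c`, rounded up. -/
lemma IsGood.card_indices_le {S : Labelling V ι} {G : SimpleGraph V} {η δ c : ℝ} {d R : ℕ}
    (hS : S.IsGood G η δ) (hV : 0 < Fintype.card V) (hδ : 0 < δ) (hc : 0 < c)
    (hG : ∀ v, deg G v = d) (hd : c * (Fintype.card V : ℝ) ≤ d) (hR : 1 / c ≤ R)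
    (hη : (R + 1) * η < c * δ) : #S.indices ≤ R := by
  set n : ℝ := (Fintype.card V : ℝ) with hn
  have hn0 : 0 < n := by rw [hn]; exact_mod_cast hV
  -- A vertex of a cluster `Z` has at least `d - |Z|` wrong neighbours, so `|Z| (d - |Z|) ≤ ηn²`.
  -- Since `|Z| ≥ δn`, this gives `d - |Z| ≤ ηn/δ`.
  have hsize : ∀ i ∈ S.indices, (c - η / δ) * n ≤ #(S.cluster i) := by
    intro i hi
    have hz := hS.le_card_cluster hi
    rw [← hn] at hz
    have hz0 : (0 : ℝ) < #(S.cluster i) := lt_of_lt_of_le (by positivity) hz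
    have h1 : ∑ v ∈ S.cluster i, ((d : ℝ) - #(S.cluster i)) ≤
        ∑ v ∈ S.cluster i, (deg (S.wrong G) v : ℝ) := by
      apply sum_le_sum
      intro v hv
      have h2 := S.deg_add_deg G v
      have h3 := S.deg_right_le_cluster G v
      rw [mem_cluster.1 hv] at h3
      rw [hG] at h2
      have : d ≤ deg (S.wrong G) v + #(S.cluster i) := by omega
      have : (d : ℝ) ≤ deg (S.wrong G) v + #(S.cluster i) := by exact_mod_cast this
      linarith
    have h2 : ∑ v ∈ S.cluster i, (deg (S.wrong G) v : ℝ) ≤ η * n ^ 2 := by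
      refine le_trans ?_ hS.wrong_le
      apply sum_le_sum_of_subset_of_nonneg (subset_univ _)
      intros; positivity
    rw [sum_const, nsmul_eq_mul] at h1
    by_contra hcon
    push Not at hcon
    have h3 : η / δ * n < d - #(S.cluster i) := by nlinarith
    have hη0 : 0 ≤ η * n ^ 2 := le_trans (sum_nonneg fun v _ => by positivity) hS.wrong_le
    have hη1 : 0 ≤ η := nonneg_of_mul_nonneg_left hη0 (by positivity)
    have h4 : δ * n * (η / δ * n) < #(S.cluster i) * (d - #(S.cluster i)) := by
      have : 0 ≤ η / δ * n := by positivity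
      calc δ * n * (η / δ * n) ≤ #(S.cluster i) * (η / δ * n) := by gcongr
        _ < _ := by gcongr
    have h5 : δ * n * (η / δ * n) = η * n ^ 2 := by field_simp
    linarith
  by_contra hcon
  push Not at hcon
  have hsum : ∑ i ∈ S.indices, (#(S.cluster i) : ℝ) = n := by
    rw [hn]
    have : ∑ i ∈ S.indices, #(S.cluster i) = Fintype.card V := by
      rw [← card_univ]
      exact (card_eq_sum_card_image S.cl univ).symm
    exact_mod_cast this
  have h1 : (#S.indices : ℝ) * ((c - η / δ) * n) ≤ n := by
    have := sum_le_sum hsize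
    rwa [hsum, sum_const, nsmul_eq_mul] at this
  have h2 : (R + 1 : ℝ) ≤ #S.indices := by exact_mod_cast hcon
  rw [div_le_iff₀ hc] at hR
  -- Now `(R + 1) c ≥ 1 + c`, so `R + 1` clusters of this size would exceed `n` vertices.
  have h3 : (R + 1) * (η / δ) < c := by
    rw [mul_div_assoc', div_lt_iff₀ hδ]; exact hη
  have h4 : 0 < c - η / δ := by
    by_contra h
    have h5 : c ≤ η / δ := by linarith
    have hR0 : (0 : ℝ) ≤ R := by positivity
    nlinarith
  have h5 : (R + 1) * ((c - η / δ) * n) ≤ n := le_trans (by gcongr) h1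
  have h6 : 1 < (R + 1) * (c - η / δ) := by nlinarith
  nlinarith

end

universe u

/-- Refining a labelling again and again ends at a terminal one, on a scale `(η, ζ, γ)` out of a
finite list. -/
lemma exists_isTerminal (rel : ℝ → ℝ → ℝ → Prop)
    (hrel : ∀ e > 0, ∃ η ζ γ : ℝ, 0 < η ∧ 0 < ζ ∧ 0 < γ ∧ η ≤ e ∧ ζ ≤ e ∧ γ ≤ e ∧ rel η ζ γ)
    {c δ : ℝ} (hc : 0 < c) (hδ : 0 < δ) {R : ℕ} (hR : 1 / c ≤ R) (j : ℕ) :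
    ∃ η₀ > 0, ∀ (V : Type u) [Fintype V] (G : SimpleGraph V) (d : ℕ)
      (S : Labelling V (Fin (R + 1))), 0 < Fintype.card V → (∀ v, deg G v = d) →
      c * (Fintype.card V : ℝ) ≤ d → S.IsGood G η₀ (4 ^ j * δ) → 2 * R + 1 ≤ S.potential + j →
      ∃ (η ζ γ : ℝ) (S' : Labelling V (Fin (R + 1))), η₀ ≤ η ∧ 0 < ζ ∧ 0 < γ ∧ rel η ζ γ ∧
        S'.IsGood G η δ ∧ #S'.indices ≤ R ∧ S'.IsTerminal G (4 * ζ) (2 * γ) := by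
  have hR1 : (0 : ℝ) < R + 1 := by positivity
  induction j with
  | zero =>
    -- With no step left the potential would exceed `2R`, although at most `R` clusters exist and
    -- each counts at most twice.
    refine ⟨c * δ / (2 * (R + 1)), by positivity, ?_⟩
    intro V _ G d S hV hG hd hS hpot
    exfalso
    have h1 : #S.indices ≤ R := hS.card_indices_le hV (by simpa using hδ) hc hG hd hR (by
      have h2 : (R + 1 : ℝ) * (c * δ / (2 * (R + 1))) = c * δ / 2 := by field_simp
      rw [h2]
      have : 0 < c * δ := by positivity
      simp only [pow_zero, one_mul]
      linarith)
    have h2 : #{i ∈ S.indices | i ∈ S.bip} ≤ #S.indices := card_filter_le _ _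
    unfold potential at hpot
    omega
  | succ j ih =>
    obtain ⟨η₁, hη₁, ih⟩ := ih
    -- A step has parameter `x = 4ζ` or `2γ`, so `x ≤ 4e`. The three bounds keep `η + 2x + 8x/δ'`
    -- below the threshold `η₁` of the next stage, give `16x ≤ δ'²`, and bound the number of
    -- clusters.
    set e : ℝ := min (η₁ / (9 + 32 / δ)) (min (δ ^ 2 / 64) (c * δ / (2 * (R + 1)))) with he
    have he0 : 0 < e := by positivity
    obtain ⟨η, ζ, γ, hη, hζ, hγ, hηe, hζe, hγe, hr⟩ := hrel e he0
    have he1 : e * (9 + 32 / δ) ≤ η₁ := by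
      rw [← le_div_iff₀ (by positivity)]
      exact min_le_left _ _
    have he2 : e ≤ δ ^ 2 / 64 := (min_le_right _ _).trans (min_le_left _ _)
    have he3 : e ≤ c * δ / (2 * (R + 1)) := (min_le_right _ _).trans (min_le_right _ _)
    have hηη₁ : η ≤ η₁ := by
      have : 0 < e * (8 + 32 / δ) := by positivity
      nlinarith
    -- The threshold of this stage is the `η` of its own scale: either the labelling is terminal at
    -- this scale, or one step leads to the next stage.
    refine ⟨η, hη, ?_⟩
    intro V _ G d S hV hG hd hS hpot
    set δ' : ℝ := 4 ^ (j + 1) * δ with hδ'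
    have hδδ' : δ ≤ δ' := by
      have : (1 : ℝ) ≤ 4 ^ (j + 1) := one_le_pow₀ (by norm_num)
      nlinarith
    have hδ'0 : 0 < δ' := hδ.trans_le hδδ'
    have hδ'4 : δ' / 4 = 4 ^ j * δ := by rw [hδ', pow_succ]; ring
    have hind : #S.indices ≤ R := (hS.mono le_rfl hδδ').card_indices_le hV hδ hc hG hd hR (by
      calc (R + 1 : ℝ) * η ≤ (R + 1) * (c * δ / (2 * (R + 1))) := by gcongr; linarith
        _ = c * δ / 2 := by field_simp
        _ < c * δ := by have : 0 < c * δ := by positivity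
                        linarith)
    have hδ'1 : δ' ≤ 1 := by
      obtain ⟨v⟩ := Fintype.card_pos_iff.1 hV
      have h1 := hS.le_right v
      have h2 : (deg (S.right G) v : ℝ) ≤ Fintype.card V := by
        exact_mod_cast card_le_univ _
      have h3 : (0 : ℝ) < Fintype.card V := by exact_mod_cast hV
      by_contra hcon
      push Not at hcon
      nlinarith
    have hsmall : ∀ x : ℝ, 0 < x → x ≤ 4 * e →
        16 * x ≤ δ' ^ 2 ∧ η + (2 * x + 8 * x / δ') ≤ η₁ := by
      intro x hx hxe
      constructor
      · have : δ ^ 2 ≤ δ' ^ 2 := by gcongr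
        linarith
      · have h1 : 8 * x / δ' ≤ 8 * (4 * e) / δ := by gcongr
        have h2 : 8 * (4 * e) / δ = e * (32 / δ) := by ring
        nlinarith
    have hcont : ∀ S' : Labelling V (Fin (R + 1)), ∀ x, 0 < x → x ≤ 4 * e →
        S'.IsGood G (η + (2 * x + 8 * x / δ')) (δ' / 4) → S.potential + 1 ≤ S'.potential →
        ∃ (η' ζ γ : ℝ) (S' : Labelling V (Fin (R + 1))), η ≤ η' ∧ 0 < ζ ∧ 0 < γ ∧ rel η' ζ γ ∧
          S'.IsGood G η' δ ∧ #S'.indices ≤ R ∧ S'.IsTerminal G (4 * ζ) (2 * γ) := by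
      intro S' x hx hxe hS' hpot'
      obtain ⟨η', ζ', γ', S'', h1, h2⟩ := ih V G d S' hV hG hd
        (hS'.mono (hsmall x hx hxe).2 hδ'4.ge) (by omega)
      exact ⟨η', ζ', γ', S'', hηη₁.trans h1, h2⟩
    by_cases hterm : S.IsTerminal G (4 * ζ) (2 * γ)
    · exact ⟨η, ζ, γ, S, le_rfl, hζ, hγ, hr, hS.mono le_rfl hδδ', hind, hterm⟩
    · unfold IsTerminal at hterm
      push Not at hterm
      obtain ⟨i, hi, hi2⟩ := hterm
      by_cases hcut : NoSparseCuts ((S.right G).induce (S.cluster i : Set V)) (4 * ζ)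
      · obtain ⟨hib, hfar⟩ := hi2 hcut
        obtain ⟨S', hS', hpot'⟩ := hS.exists_mark hV hδ'0
          (hsmall (2 * γ) (by positivity) (by linarith)).1 hi hib hfar
        exact hcont S' (2 * γ) (by positivity) (by linarith) hS' hpot'
      -- At most `R` of the `R + 1` indices are in use, so one is free for the split.
      · obtain ⟨i', hi'⟩ : ∃ i', i' ∉ S.indices := by
          by_contra hcon
          push Not at hcon
          have := card_le_card (fun x _ => hcon x : univ ⊆ S.indices)
          rw [card_univ, Fintype.card_fin] at this
          omega
        obtain ⟨S', hS', hpot'⟩ := hS.exists_split hV hδ'0 hδ'1 (by positivity)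
          (hsmall (4 * ζ) (by positivity) (by linarith)).1 hi hi' hcut
        exact hcont S' (4 * ζ) (by positivity) (by linarith) hS' hpot'

end Labelling

/-! ### Copies of `K_{t,t}` and common neighbourhoods -/

section Blocks

variable {V : Type*}

/-- The sets `A` and `B` are the sides of a copy of `K_{t,t}` in `G`. -/
structure IsBlock (G : SimpleGraph V) (t : ℕ) (A B : Finset V) : Prop where
  card_left : #A = t
  card_right : #B = t
  disjoint : Disjoint A B
  adj : ∀ a ∈ A, ∀ b ∈ B, G.Adj a b

/-- Disjoint blocks with union `L` form a perfect packing of `G[L]`. -/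
lemma hasPerfectPacking_of_blocks (G : SimpleGraph V) (t : ℕ)
    (𝒬 : Set (Finset V × Finset V)) (L : Finset V)
    (hblock : ∀ q ∈ 𝒬, IsBlock G t q.1 q.2)
    (hdisj : 𝒬.PairwiseDisjoint (fun q => q.1 ∪ q.2))
    (hL : ∀ v, v ∈ L ↔ ∃ q ∈ 𝒬, v ∈ q.1 ∪ q.2) :
    HasPerfectPacking (completeBipartiteGraph (Fin t) (Fin t)) (G.induce (L : Set V)) := by
  -- This relation determines `K` from `q`, so distinct subgraphs come from distinct, hence
  -- disjoint, blocks.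
  let isOf : (G.induce (L : Set V)).Subgraph → Finset V × Finset V → Prop := fun K q =>
    (∀ x, x ∈ K.verts ↔ x.1 ∈ q.1 ∨ x.1 ∈ q.2) ∧
    ∀ x y, K.Adj x y ↔ (x.1 ∈ q.1 ∧ y.1 ∈ q.2) ∨ (x.1 ∈ q.2 ∧ y.1 ∈ q.1)
  have hex : ∀ q ∈ 𝒬, ∃ K, isOf K q := by
    intro q hq
    have hb := hblock q hq
    exact ⟨{  verts := {x | x.1 ∈ q.1 ∨ x.1 ∈ q.2}
              Adj := fun x y => (x.1 ∈ q.1 ∧ y.1 ∈ q.2) ∨ (x.1 ∈ q.2 ∧ y.1 ∈ q.1)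
              adj_sub := by
                rintro x y (h | h)
                · exact hb.adj _ h.1 _ h.2
                · exact (hb.adj _ h.2 _ h.1).symm
              edge_vert := by
                rintro x y (h | h)
                · exact Or.inl h.1
                · exact Or.inr h.1
              symm := ⟨by
                rintro x y (h | h)
                · exact Or.inr ⟨h.2, h.1⟩
                · exact Or.inl ⟨h.2, h.1⟩⟩ }, fun x => Iff.rfl, fun x y => Iff.rfl⟩
  refine ⟨{K | ∃ q ∈ 𝒬, isOf K q}, ?_, ?_, ?_⟩
  · rintro K ⟨q, hq, hK1, hK2⟩
    have hb := hblock q hq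
    have hLq : ∀ v, v ∈ q.1 ∨ v ∈ q.2 → v ∈ (L : Set V) := fun v hv =>
      (hL v).2 ⟨q, hq, mem_union.2 hv⟩
    let eA := (q.1.equivFinOfCardEq hb.card_left).symm
    let eB := (q.2.equivFinOfCardEq hb.card_right).symm
    let f : Fin t ⊕ Fin t → K.verts := Sum.elim
      (fun i => ⟨⟨(eA i).1, hLq _ (Or.inl (eA i).2)⟩, (hK1 _).2 (Or.inl (eA i).2)⟩)
      (fun i => ⟨⟨(eB i).1, hLq _ (Or.inr (eB i).2)⟩, (hK1 _).2 (Or.inr (eB i).2)⟩)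
    have hne : ∀ i j, (eA i).1 ≠ (eB j).1 := fun i j h =>
      disjoint_left.1 hb.disjoint (eA i).2 (h ▸ (eB j).2)
    have hbij : Function.Bijective f := by
      constructor
      · rintro (i | i) (j | j) h
        · simp only [f, Sum.elim_inl, Subtype.mk.injEq] at h
          exact congrArg _ (eA.injective (Subtype.ext h))
        · simp only [f, Sum.elim_inl, Sum.elim_inr, Subtype.mk.injEq] at h
          exact absurd h (hne i j)
        · simp only [f, Sum.elim_inl, Sum.elim_inr, Subtype.mk.injEq] at h
          exact absurd h.symm (hne j i)
        · simp only [f, Sum.elim_inr, Subtype.mk.injEq] at h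
          exact congrArg _ (eB.injective (Subtype.ext h))
      · rintro ⟨⟨v, hv⟩, hvK⟩
        rcases (hK1 _).1 hvK with h | h
        · exact ⟨Sum.inl (eA.symm ⟨v, h⟩), by simp [f]⟩
        · exact ⟨Sum.inr (eB.symm ⟨v, h⟩), by simp [f]⟩
    have hA : ∀ i, (eA i).1 ∈ q.1 := fun i => (eA i).2
    have hB : ∀ i, (eB i).1 ∈ q.2 := fun i => (eB i).2
    have hA' : ∀ i, (eA i).1 ∉ q.2 := fun i => disjoint_left.1 hb.disjoint (hA i)
    have hB' : ∀ i, (eB i).1 ∉ q.1 := fun i => disjoint_right.1 hb.disjoint (hB i)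
    refine ⟨(RelIso.mk (Equiv.ofBijective f hbij) ?_ :
      completeBipartiteGraph (Fin t) (Fin t) ≃g K.coe).symm⟩
    rintro (i | i) (j | j) <;>
      simp [f, hK2, completeBipartiteGraph, hA, hB, hA', hB']
  · rintro K ⟨q, hq, hK1, hK2⟩ K' ⟨q', hq', hK1', hK2'⟩ hne
    by_cases hqq : q = q'
    · subst hqq
      refine absurd ?_ hne
      ext x y
      · rw [hK1, hK1']
      · rw [hK2, hK2']
    · have := hdisj hq hq' hqq
      rw [Function.onFun, Set.disjoint_left]
      intro x hx hx'
      rw [hK1, ← mem_union] at hx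
      rw [hK1', ← mem_union] at hx'
      exact disjoint_left.1 this hx hx'
  · rw [Set.eq_univ_iff_forall]
    intro x
    obtain ⟨q, hq, hxq⟩ := (hL x.1).1 x.2
    obtain ⟨K, hK⟩ := hex q hq
    simp only [Set.mem_iUnion]
    exact ⟨K, ⟨q, hq, hK⟩, (hK.1 x).2 (mem_union.1 hxq)⟩

/-- Among many vertices of linear degree, some `t` have `t - 1` common neighbours outside a given
set that is not too large. -/
lemma exists_common_neighbours [Fintype V] (H : SimpleGraph V) {δ : ℝ} {t D : ℕ} (ht : 1 ≤ t)
    (hδ : 0 < δ) (hD : 4 * (t : ℝ) ≤ δ * D) {B F : Finset V} (hB : D ≤ #B)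
    (hdeg : ∀ u ∈ B, δ * (Fintype.card V : ℝ) ≤ deg H u)
    (hF : (#F : ℝ) ≤ δ / 2 * (Fintype.card V : ℝ))
    (hn : (t : ℝ) * 2 ^ (D + 2) ≤ δ * (Fintype.card V : ℝ)) :
    ∃ B' ⊆ B, #B' = t ∧ ∃ Y : Finset V, #Y = t - 1 ∧ Disjoint Y F ∧
      ∀ y ∈ Y, ∀ b ∈ B', H.Adj b y := by
  set n : ℝ := (Fintype.card V : ℝ) with hndef
  obtain ⟨B₀, hB₀, hB₀D⟩ := exists_subset_card_eq hB
  have hD0 : (0 : ℝ) < D := by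
    have : (1 : ℝ) ≤ t := by exact_mod_cast ht
    by_contra h
    nlinarith
  let Y₀ : Finset V := {y ∈ Fᶜ | t ≤ #{u ∈ B₀ | H.Adj u y}}
  -- Double counting between `D` vertices `B₀` and the complement of `F`: vertices outside `Y₀` see
  -- at most `t` of `B₀`. As `t ≤ δD/4`, at least `δn/4` vertices lie in `Y₀`.
  have hcount : (D : ℝ) * (δ / 2 * n) ≤ #Y₀ * D + n * t := by
    calc (D : ℝ) * (δ / 2 * n) = ∑ u ∈ B₀, δ / 2 * n := by simp [hB₀D]
      _ ≤ ∑ u ∈ B₀, (#{y ∈ Fᶜ | H.Adj u y} : ℝ) := by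
        apply sum_le_sum
        intro u hu
        have h1 := hdeg u (hB₀ hu)
        have h2 : deg H u ≤ #{y ∈ Fᶜ | H.Adj u y} + #F := by
          have : ({y | H.Adj u y} : Finset V) ⊆ {y ∈ Fᶜ | H.Adj u y} ∪ F := by
            intro y hy
            by_cases hyF : y ∈ F
            · exact mem_union_right _ hyF
            · exact mem_union_left _ (mem_filter.2 ⟨mem_compl.2 hyF, (mem_filter.1 hy).2⟩)
          exact (card_le_card this).trans (card_union_le _ _)
        have h3 : (deg H u : ℝ) ≤ #{y ∈ Fᶜ | H.Adj u y} + #F := by exact_mod_cast h2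
        linarith
      _ = ∑ y ∈ Fᶜ, (#{u ∈ B₀ | H.Adj u y} : ℝ) := by
        have : ∑ u ∈ B₀, #{y ∈ Fᶜ | H.Adj u y} = ∑ y ∈ Fᶜ, #{u ∈ B₀ | H.Adj u y} := by
          simp_rw [card_filter]
          exact sum_comm
        exact_mod_cast this
      _ ≤ ∑ y ∈ Fᶜ, ((if y ∈ Y₀ then (D : ℝ) else 0) + t) := by
        apply sum_le_sum
        intro y hy
        split_ifs with hyY
        · have h1 : #{u ∈ B₀ | H.Adj u y} ≤ D := hB₀D ▸ card_filter_le _ _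
          have h2 : (#{u ∈ B₀ | H.Adj u y} : ℝ) ≤ D := by exact_mod_cast h1
          have h3 : (0 : ℝ) ≤ t := by positivity
          linarith
        · have h1 : #{u ∈ B₀ | H.Adj u y} ≤ t := by
            by_contra h
            exact hyY (mem_filter.2 ⟨hy, by omega⟩)
          rw [zero_add]
          exact_mod_cast h1
      _ ≤ #Y₀ * D + n * t := by
        rw [sum_add_distrib, ← sum_filter, sum_const, sum_const, nsmul_eq_mul, nsmul_eq_mul]
        have h1 : #(filter (· ∈ Y₀) Fᶜ) ≤ #Y₀ := card_le_card fun y hy => (mem_filter.1 hy).2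
        have h2 : (#Fᶜ : ℝ) ≤ n := by rw [hndef]; exact_mod_cast card_le_univ _
        gcongr
  have hY₀ : 2 ^ D * t ≤ #Y₀ := by
    have hn0 : 0 ≤ n := by positivity
    have h1 : (D : ℝ) * (δ / 4 * n) ≤ #Y₀ * D := by nlinarith
    have h2 : δ / 4 * n ≤ #Y₀ := by
      rw [mul_comm (#Y₀ : ℝ)] at h1
      exact le_of_mul_le_mul_left h1 hD0
    have h3 : (2 : ℝ) ^ D * t ≤ #Y₀ := by
      rw [pow_add] at hn
      linarith
    exact_mod_cast h3
  have hsub : ∀ y ∈ Y₀, ∃ T ⊆ ({u ∈ B₀ | H.Adj u y} : Finset V), #T = t := fun y hy =>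
    exists_subset_card_eq (mem_filter.1 hy).2
  choose! T hT1 hT2 using hsub
  -- Pigeonhole over the `2 ^ D` subsets of `B₀`. A fibre of size `t` rather than `t - 1` is
  -- requested so that it is non-empty even for `t = 1`, which is what gives `B'` its size.
  obtain ⟨B', hB', hcard⟩ := exists_le_card_fiber_of_mul_le_card_of_maps_to (s := Y₀)
    (t := B₀.powerset) (f := T) (n := t)
    (fun y hy => mem_powerset.2 ((hT1 y hy).trans (filter_subset _ _)))
    ⟨∅, empty_mem_powerset _⟩ (by rw [card_powerset, hB₀D]; exact hY₀)
  obtain ⟨Y, hY, hYc⟩ := exists_subset_card_eq (show t - 1 ≤ #{y ∈ Y₀ | T y = B'} by omega)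
  obtain ⟨y₀, hy₀⟩ : ({y ∈ Y₀ | T y = B'} : Finset V).Nonempty := by
    rw [← card_pos]; omega
  rw [mem_filter] at hy₀
  refine ⟨B', (mem_powerset.1 hB').trans hB₀, hy₀.2 ▸ hT2 y₀ hy₀.1, Y, hYc, ?_, ?_⟩
  · rw [disjoint_left]
    intro y hy
    exact mem_compl.1 (mem_filter.1 (mem_filter.1 (hY hy)).1).1
  · intro y hy b hb
    have h1 := mem_filter.1 (hY hy)
    rw [← h1.2] at hb
    exact (mem_filter.1 (hT1 y h1.1 hb)).2

end Blocks

/-! ### Imbalance, classes of vertices and gadgets -/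

namespace Labelling

variable {V : Type*} {ι : Type*}

/-- The cluster and the side of a vertex. -/
def lab (S : Labelling V ι) (v : V) : ι × Bool := (S.cl v, S.side v)

/-- `1` and `-1` on the two sides of the cluster `i`, and `0` elsewhere. -/
noncomputable def sgn (i : ι) (q : ι × Bool) : ℝ :=
  if q.1 = i then (if q.2 then 1 else -1) else 0

lemma abs_sgn_le (i : ι) (q : ι × Bool) : |sgn i q| ≤ 1 := by
  unfold sgn
  split_ifs <;> simp

/-- Right edges cross the sides of cluster `i` or avoid it altogether. This makes right edges cancel
in the signed degree count, and places the common neighbours of a gadget opposite to its leaves. -/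
lemma sgn_lab_of_right {S : Labelling V ι} {G : SimpleGraph V} {i : ι} (hi : i ∈ S.bip)
    {u v : V} (h : (S.right G).Adj u v) : sgn i (S.lab v) = -sgn i (S.lab u) := by
  obtain ⟨-, h1, h2⟩ := h
  unfold sgn lab
  simp only [← h1]
  by_cases hu : S.cl u = i
  · have h3 := h2 (hu ▸ hi)
    simp only [hu, if_true]
    revert h3
    cases S.side u <;> cases S.side v <;> simp
  · simp [hu]

/-- The possible classes of vertices: a label, and a set of labels in which there are many wrong
neighbours. -/
abbrev Kind (ι : Type*) := (ι × Bool) × Finset (ι × Bool)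

/-- The vertices of class `a` have many wrong neighbours in the label of `b`. -/
def High (a b : Kind ι) : Prop := b.1 ∈ a.2

/-- The share of the wrong edges from `a` to `b` that is attributed to `a`. -/
noncomputable def share (a b : Kind ι) : ℝ :=
  if High a b then (if High b a then 1 / 2 else 1) else (if High b a then 0 else 1 / 2)

/-- The two orientations together account for each wrong edge exactly once. -/
lemma share_add_share (a b : Kind ι) : share a b + share b a = 1 := by
  unfold share
  split_ifs <;> norm_num

lemma share_nonneg (a b : Kind ι) : 0 ≤ share a b := by
  unfold share
  split_ifs <;> norm_num

lemma share_le_one (a b : Kind ι) : share a b ≤ 1 := by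
  unfold share
  split_ifs <;> norm_num

variable [Fintype V]

/-- The imbalance of a bipartite cluster is determined by the wrong edges. -/
lemma sum_sgn_mul_deg_wrong (S : Labelling V ι) (G : SimpleGraph V) {d : ℕ}
    (hG : ∀ v, deg G v = d) {i : ι} (hi : i ∈ S.bip) :
    ∑ v, sgn i (S.lab v) * (deg (S.wrong G) v : ℝ) = d * ∑ v, sgn i (S.lab v) := by
  have h0 : ∑ v, sgn i (S.lab v) * (deg (S.right G) v : ℝ) = 0 := by
    have h1 : ∀ v, sgn i (S.lab v) * (deg (S.right G) v : ℝ) =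
        ∑ u, if (S.right G).Adj v u then sgn i (S.lab v) else 0 := by
      intro v
      unfold deg
      rw [← sum_filter, sum_const, nsmul_eq_mul, mul_comm]
    simp_rw [h1]
    -- Reversing a right edge changes the sign of its first end, so the sum is its own negative.
    have h2 : ∑ v, ∑ u, (if (S.right G).Adj v u then sgn i (S.lab v) else 0) =
        -∑ v, ∑ u, (if (S.right G).Adj v u then sgn i (S.lab v) else 0) := by
      conv_lhs => rw [sum_comm]
      rw [← sum_neg_distrib]
      apply sum_congr rfl
      intro v _
      rw [← sum_neg_distrib]
      apply sum_congr rfl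
      intro u _
      rw [(S.right G).adj_comm u v]
      split_ifs with h
      · rw [sgn_lab_of_right hi h]
      · simp
    linarith
  have h1 : ∀ v, (deg (S.wrong G) v : ℝ) = d - deg (S.right G) v := by
    intro v
    have := S.deg_add_deg G v
    rw [hG] at this
    have : (deg (S.right G) v : ℝ) + deg (S.wrong G) v = d := by exact_mod_cast this
    linarith
  simp_rw [h1, mul_sub]
  rw [sum_sub_distrib, h0, sub_zero, mul_sum]
  exact sum_congr rfl fun v _ => mul_comm _ _

variable [Fintype ι]

/-- The labels in which `v` has at least `h` wrong neighbours. -/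
noncomputable def heavy (S : Labelling V ι) (G : SimpleGraph V) (h : ℝ) (v : V) :
    Finset (ι × Bool) :=
  {q | h ≤ (#{u | (S.wrong G).Adj v u ∧ S.lab u = q} : ℝ)}

/-- The class of a vertex: its label, and the labels in which it has many wrong neighbours. -/
noncomputable def kind (S : Labelling V ι) (G : SimpleGraph V) (h : ℝ) (v : V) :
    Kind ι :=
  (S.lab v, S.heavy G h v)

/-- The vertices of a given class. -/
noncomputable def kindSet (S : Labelling V ι) (G : SimpleGraph V) (h : ℝ)
    (a : Kind ι) : Finset V := {v | S.kind G h v = a}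

/-- The vertices with many wrong neighbours in some label. -/
noncomputable def heavySet (S : Labelling V ι) (G : SimpleGraph V) (h : ℝ) : Finset V :=
  {v | S.heavy G h v ≠ ∅}

/-- The number of wrong edges from class `a` to class `b`. -/
noncomputable def darts (S : Labelling V ι) (G : SimpleGraph V) (h : ℝ)
    (a b : Kind ι) : ℕ :=
  cut (S.wrong G) (S.kindSet G h a) (S.kindSet G h b)

lemma darts_comm (S : Labelling V ι) (G : SimpleGraph V) (h : ℝ)
    (a b : Kind ι) : S.darts G h a b = S.darts G h b a :=
  cut_comm _ _ _

lemma sum_darts (S : Labelling V ι) (G : SimpleGraph V) (h : ℝ)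
    (a : Kind ι) :
    ∑ b, S.darts G h a b = ∑ v ∈ S.kindSet G h a, deg (S.wrong G) v := by
  unfold darts
  simp_rw [cut_eq_sum]
  rw [sum_comm]
  apply sum_congr rfl
  intro v _
  unfold deg
  rw [card_eq_sum_card_fiberwise (f := S.kind G h) (t := univ) (fun _ _ => mem_univ _)]
  apply sum_congr rfl
  intro b _
  congr 1
  ext u
  simp [kindSet, and_comm]

lemma sum_sum_darts (S : Labelling V ι) (G : SimpleGraph V) (h : ℝ) :
    ∑ p : Kind ι × Kind ι,
      S.darts G h p.1 p.2 = ∑ v, deg (S.wrong G) v := by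
  rw [Fintype.sum_prod_type]
  simp_rw [sum_darts]
  exact sum_fiberwise univ (S.kind G h) _

/-- The number of copies of `K_{t,t}` to be placed with centre in class `a` and leaves in the
label of `b`. -/
noncomputable def demand (S : Labelling V ι) (G : SimpleGraph V) (h : ℝ) (D d : ℕ)
    (p : Kind ι × Kind ι) : ℕ :=
  if ¬ High p.1 p.2 ∧ S.darts G h p.1 p.2 ≤ 2 * D * Fintype.card V then 0
  else ⌊share p.1 p.2 * S.darts G h p.1 p.2 / d⌋₊

lemma demand_le (S : Labelling V ι) (G : SimpleGraph V) (h : ℝ) (D d : ℕ)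
    (p : Kind ι × Kind ι) :
    (S.demand G h D d p : ℝ) ≤ share p.1 p.2 * S.darts G h p.1 p.2 / d := by
  have h0 : 0 ≤ share p.1 p.2 * S.darts G h p.1 p.2 / d := by
    have := share_nonneg p.1 p.2
    positivity
  unfold demand
  split_ifs
  · exact_mod_cast h0
  · exact Nat.floor_le h0

/-- Rounding down loses at most `1`, and a demand set to zero for having at most `2Dn` darts loses
at most `2Dn / (cn)`. -/
lemma le_demand_add (S : Labelling V ι) (G : SimpleGraph V) (h : ℝ) (D d : ℕ) {c : ℝ}
    (hc : 0 < c) (hV : 0 < Fintype.card V) (hd : c * (Fintype.card V : ℝ) ≤ d)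
    (p : Kind ι × Kind ι) :
    share p.1 p.2 * S.darts G h p.1 p.2 / d ≤ S.demand G h D d p + (2 * D / c + 1) := by
  have hn : (0 : ℝ) < Fintype.card V := by exact_mod_cast hV
  have hd0 : (0 : ℝ) < d := lt_of_lt_of_le (by positivity) hd
  have hD : (0 : ℝ) ≤ 2 * D / c := by positivity
  unfold demand
  split_ifs with hl
  · have h1 : (S.darts G h p.1 p.2 : ℝ) ≤ 2 * D * Fintype.card V := by exact_mod_cast hl.2
    have h2 : share p.1 p.2 * S.darts G h p.1 p.2 ≤ 1 * (2 * D * Fintype.card V) := by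
      gcongr
      exact share_le_one _ _
    have h3 : share p.1 p.2 * S.darts G h p.1 p.2 / d ≤ 2 * D / c := by
      rw [div_le_div_iff₀ hd0 hc]
      calc _ ≤ 1 * (2 * D * Fintype.card V) * c := by gcongr
        _ = 2 * D * (c * Fintype.card V) := by ring
        _ ≤ _ := by gcongr
    push_cast
    linarith
  · have := Nat.lt_floor_add_one (share p.1 p.2 * S.darts G h p.1 p.2 / d)
    linarith

/-- The vertex `v` of class `a`, the leaves `B` with the label of `b` and the common neighbours
`Y` of the leaves form a copy of `K_{t,t}`. -/
structure IsGadget (S : Labelling V ι) (G : SimpleGraph V) (h : ℝ) (t : ℕ)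
    (p : Kind ι × Kind ι)
    (v : V) (Y B : Finset V) : Prop where
  kind_centre : S.kind G h v = p.1
  card_leaves : #B = t
  lab_leaves : ∀ u ∈ B, S.lab u = p.2.1
  adj_leaves : ∀ u ∈ B, G.Adj v u
  leaves : ∀ u ∈ B, S.heavy G h u = ∅ ∨ (S.kind G h u = p.2 ∧ ¬ High p.1 p.2)
  card_common : #Y = t - 1
  heavy_common : ∀ y ∈ Y, S.heavy G h y = ∅
  adj_common : ∀ y ∈ Y, ∀ u ∈ B, (S.right G).Adj u y
  centre_notMem : v ∉ Y

/-- The set `U` is a disjoint union of gadgets, `g p` of them with classes `p`. -/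
inductive GadgetUnion (S : Labelling V ι) (G : SimpleGraph V) (h : ℝ) (t : ℕ) :
    Finset V → (Kind ι × Kind ι → ℕ) → Prop
  | empty : GadgetUnion S G h t ∅ (fun _ => 0)
  | add {U : Finset V} {g : _ → ℕ}
      {p : Kind ι × Kind ι}
      {v : V} {Y B : Finset V} (hU : GadgetUnion S G h t U g)
      (hp : S.IsGadget G h t p v Y B) (hd : Disjoint (insert v Y ∪ B) U) :
      GadgetUnion S G h t ((insert v Y ∪ B) ∪ U) (fun q => g q + if q = p then 1 else 0)

section Gadget

variable {S : Labelling V ι} {G : SimpleGraph V} {h : ℝ} {t : ℕ}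
  {p : Kind ι × Kind ι}
  {v : V} {Y B U : Finset V}
  {g : Kind ι × Kind ι → ℕ}

lemma IsGadget.isBlock (ht : 1 ≤ t) (hp : S.IsGadget G h t p v Y B) :
    IsBlock G t (insert v Y) B where
  card_left := by rw [card_insert_of_notMem hp.centre_notMem, hp.card_common]; omega
  card_right := hp.card_leaves
  disjoint := by
    rw [disjoint_left]
    intro a ha haB
    rcases mem_insert.1 ha with rfl | ha
    · exact G.loopless.irrefl _ (hp.adj_leaves a haB)
    · exact (S.right G).loopless.irrefl _ (hp.adj_common a ha a haB)
  adj := by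
    intro a ha b hb
    rcases mem_insert.1 ha with rfl | ha
    · exact hp.adj_leaves b hb
    · exact (hp.adj_common a ha b hb).1.symm

lemma sum_add_ite_mul {P : Type*} [Fintype P] [DecidableEq P] (g : P → ℕ) (w : P → ℝ) (p : P) :
    ∑ q, ((g q + if q = p then 1 else 0 : ℕ) : ℝ) * w q = ∑ q, (g q : ℝ) * w q + w p := by
  push_cast
  simp_rw [add_mul]
  rw [sum_add_distrib]
  simp

lemma GadgetUnion.card_eq (ht : 1 ≤ t) (hU : GadgetUnion S G h t U g) :
    #U = 2 * t * ∑ q, g q := by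
  induction hU with
  | empty => simp
  | add hU hp hd ih =>
    have hb := hp.isBlock ht
    rw [card_union_of_disjoint hd, card_union_of_disjoint hb.disjoint, hb.card_left,
      hb.card_right, ih, sum_add_distrib]
    simp
    ring

lemma GadgetUnion.exists_blocks (ht : 1 ≤ t) (hU : GadgetUnion S G h t U g) :
    ∃ 𝒬 : Set (Finset V × Finset V), (∀ q ∈ 𝒬, IsBlock G t q.1 q.2) ∧
      𝒬.PairwiseDisjoint (fun q => q.1 ∪ q.2) ∧ ∀ v, v ∈ U ↔ ∃ q ∈ 𝒬, v ∈ q.1 ∪ q.2 := by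
  induction hU with
  | empty => exact ⟨∅, by simp, by simp, by simp⟩
  | @add U g p v Y B hU hp hd ih =>
    obtain ⟨𝒬, h1, h2, h3⟩ := ih
    refine ⟨insert (insert v Y, B) 𝒬, ?_, ?_, ?_⟩
    · rintro q (rfl | hq)
      · exact hp.isBlock ht
      · exact h1 q hq
    · refine h2.insert ?_
      intro q hq _
      refine hd.mono_right ?_
      intro x hx
      exact (h3 x).2 ⟨q, hq, hx⟩
    · intro x
      rw [mem_union, h3]
      simp only [Set.mem_insert_iff, exists_eq_or_imp]

/-- The `t` leaves contribute `t` times their sign and the `t - 1` common neighbours `t - 1` times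
the opposite one. Hence a gadget weighs as much as the two ends of one wrong edge. -/
lemma GadgetUnion.sum_sgn (ht : 1 ≤ t) {i : ι} (hi : i ∈ S.bip) (hU : GadgetUnion S G h t U g) :
    ∑ v ∈ U, sgn i (S.lab v) = ∑ q, (g q : ℝ) * (sgn i q.1.1 + sgn i q.2.1) := by
  induction hU with
  | empty => simp
  | @add U g p v Y B hU hp hd ih =>
    have hb := hp.isBlock ht
    rw [sum_union hd, sum_union hb.disjoint, sum_insert hp.centre_notMem, ih]
    simp only [sum_add_ite_mul]
    have h1 : ∑ u ∈ B, sgn i (S.lab u) = t * sgn i p.2.1 := by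
      rw [sum_congr rfl (fun u hu => by rw [hp.lab_leaves u hu]), sum_const, hp.card_leaves,
        nsmul_eq_mul]
    have h2 : ∑ y ∈ Y, sgn i (S.lab y) = (t - 1 : ℝ) * -sgn i p.2.1 := by
      obtain ⟨u, hu⟩ : B.Nonempty := by rw [← card_pos, hp.card_leaves]; omega
      rw [sum_congr rfl (fun y hy => sgn_lab_of_right hi (hp.adj_common y hy u hu)), sum_const,
        hp.card_common, nsmul_eq_mul, hp.lab_leaves u hu, Nat.cast_sub ht, Nat.cast_one]
    have h3 : S.lab v = p.1.1 := congrArg Prod.fst hp.kind_centre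
    rw [h1, h2, h3]
    ring

/-- The number of vertices in a heavy class that the gadgets use. -/
lemma GadgetUnion.card_filter_kind_le (hU : GadgetUnion S G h t U g)
    {x : Kind ι} (hx : x.2 ≠ ∅) :
    (#{v ∈ U | S.kind G h v = x} : ℝ) ≤ ∑ q, (g q : ℝ) *
      ((if q.1 = x then 1 else 0) + if q.2 = x ∧ ¬ High q.1 q.2 then (t : ℝ) else 0) := by
  induction hU with
  | empty => simp
  | @add U g p v Y B hU hp hd ih =>
    simp only [sum_add_ite_mul]
    rw [filter_union]
    have h1 : (#{u ∈ insert v Y ∪ B | S.kind G h u = x} : ℝ) ≤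
        (if p.1 = x then 1 else 0) + if p.2 = x ∧ ¬ High p.1 p.2 then (t : ℝ) else 0 := by
      rw [filter_union, filter_insert]
      have hY : ({u ∈ Y | S.kind G h u = x} : Finset V) = ∅ := by
        rw [filter_eq_empty_iff]
        rintro y hy rfl
        exact hx (hp.heavy_common y hy)
      have hv : #(if S.kind G h v = x then insert v ({u ∈ Y | S.kind G h u = x} : Finset V)
          else {u ∈ Y | S.kind G h u = x}) = if p.1 = x then 1 else 0 := by
        rw [hY, hp.kind_centre]
        split_ifs <;> simp
      -- Leaves belong to a heavy class only in gadgets whose centre is not heavy towards them, and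
      -- then their class is `p.2`.
      have hB : #({u ∈ B | S.kind G h u = x} : Finset V) ≤
          if p.2 = x ∧ ¬ High p.1 p.2 then t else 0 := by
        split_ifs with hc
        · exact (card_filter_le _ _).trans hp.card_leaves.le
        · rw [nonpos_iff_eq_zero, card_eq_zero, filter_eq_empty_iff]
          rintro u hu rfl
          rcases hp.leaves u hu with h0 | h0
          · exact hx h0
          · exact hc ⟨h0.1.symm, h0.2⟩
      have h2 := (card_union_le (if S.kind G h v = x then
        insert v ({u ∈ Y | S.kind G h u = x} : Finset V)
          else {u ∈ Y | S.kind G h u = x}) ({u ∈ B | S.kind G h u = x} : Finset V))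
      rw [hv] at h2
      exact_mod_cast h2.trans (Nat.add_le_add_left hB _)
    have h2 : (#({u ∈ insert v Y ∪ B | S.kind G h u = x} ∪
        ({u ∈ U | S.kind G h u = x} : Finset V)) : ℝ) ≤
        #{u ∈ insert v Y ∪ B | S.kind G h u = x} + #{u ∈ U | S.kind G h u = x} := by
      exact_mod_cast card_union_le _ _
    linarith

end Gadget

end Labelling

/-! ### Greedy placement of the gadgets -/

namespace Labelling

variable {V : Type*} [Fintype V] {ι : Type*} [Fintype ι]

/-- The relations between the parameters under which gadgets can be placed greedily. Wrong degrees
into a label are large if they are at least `s n`, and `D` leaves are enough for a gadget. -/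
structure IsCalibrated (S : Labelling V ι) (G : SimpleGraph V) (d t D : ℕ) (c δ s η : ℝ) :
    Prop where
  card_pos : 0 < Fintype.card V
  c_pos : 0 < c
  delta_pos : 0 < δ
  s_pos : 0 < s
  one_le_t : 1 ≤ t
  deg_eq : ∀ v, deg G v = d
  le_d : c * (Fintype.card V : ℝ) ≤ d
  good : S.IsGood G η δ
  t_le : 4 * (t : ℝ) ≤ δ * D
  t_pow_le : (t : ℝ) * 2 ^ (D + 2) ≤ δ * (Fintype.card V : ℝ)
  s_le_c : 4 * t * (Fintype.card (Kind ι × Kind ι) : ℝ) * s ≤ c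
  s_le_mul : 2 * t * (Fintype.card (Kind ι) : ℝ) * s ≤ c * δ
  s_le_delta : s ≤ δ / 2
  room : 2 * t * (η / c * (Fintype.card V : ℝ)) + η / s * (Fintype.card V : ℝ) + D + 1 ≤
    s * (Fintype.card V : ℝ)

namespace IsCalibrated

variable {S : Labelling V ι} {G : SimpleGraph V} {d t D : ℕ} {c δ s η : ℝ}

lemma n_pos (hS : S.IsCalibrated G d t D c δ s η) : (0 : ℝ) < Fintype.card V := by
  exact_mod_cast hS.card_pos

lemma d_pos (hS : S.IsCalibrated G d t D c δ s η) : (0 : ℝ) < d :=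
  lt_of_lt_of_le (mul_pos hS.c_pos hS.n_pos) hS.le_d

lemma d_le (hS : S.IsCalibrated G d t D c δ s η) : (d : ℝ) ≤ Fintype.card V := by
  obtain ⟨v⟩ := Fintype.card_pos_iff.1 hS.card_pos
  rw [← hS.deg_eq v]
  exact_mod_cast card_le_univ _

/-- Here `d ≤ n` turns the right degree `δn` into `δd`. This slack keeps a heavy class from running
out of centres. -/
lemma deg_wrong_le (hS : S.IsCalibrated G d t D c δ s η) (v : V) :
    (deg (S.wrong G) v : ℝ) ≤ (1 - δ) * d := by
  have h1 := S.deg_add_deg G v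
  rw [hS.deg_eq] at h1
  have h2 : (deg (S.right G) v : ℝ) + deg (S.wrong G) v = d := by exact_mod_cast h1
  have h3 := hS.good.le_right v
  have h4 := mul_le_mul_of_nonneg_left hS.d_le hS.delta_pos.le
  linarith

/-- Markov's inequality for the wrong degrees. -/
lemma card_heavySet_le (hS : S.IsCalibrated G d t D c δ s η) :
    (#(S.heavySet G (s * Fintype.card V)) : ℝ) ≤ η / s * Fintype.card V := by
  have hn := hS.n_pos
  have hs := hS.s_pos
  set n : ℝ := (Fintype.card V : ℝ)
  have h1 : (#(S.heavySet G (s * n)) : ℝ) * (s * n) ≤ η * n ^ 2 := by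
    calc (#(S.heavySet G (s * n)) : ℝ) * (s * n) = ∑ v ∈ S.heavySet G (s * n), s * n := by simp
      _ ≤ ∑ v ∈ S.heavySet G (s * n), (deg (S.wrong G) v : ℝ) := by
        apply sum_le_sum
        intro v hv
        obtain ⟨q, hq⟩ := nonempty_iff_ne_empty.2 (mem_filter.1 hv).2
        refine (mem_filter.1 hq).2.trans ?_
        have : #{u | (S.wrong G).Adj v u ∧ S.lab u = q} ≤ deg (S.wrong G) v := by
          apply card_le_card
          intro u hu
          exact mem_filter.2 ⟨mem_univ _, (mem_filter.1 hu).2.1⟩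
        exact_mod_cast this
      _ ≤ ∑ v, (deg (S.wrong G) v : ℝ) := by
        apply sum_le_sum_of_subset_of_nonneg (subset_univ _)
        intros; positivity
      _ ≤ _ := hS.good.wrong_le
  rw [div_mul_eq_mul_div, le_div_iff₀ hs]
  have h2 : (#(S.heavySet G (s * n)) : ℝ) * s * n ≤ η * n * n := by linarith
  exact le_of_mul_le_mul_right h2 hn

/-- There is at most one gadget per `d` wrong darts, so all gadgets together occupy only a small
part of the graph. -/
lemma sum_demand_le (hS : S.IsCalibrated G d t D c δ s η) (h : ℝ) :
    ∑ p, (S.demand G h D d p : ℝ) ≤ η / c * Fintype.card V := by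
  have hn := hS.n_pos
  have hd := hS.d_pos
  have hc := hS.c_pos
  calc ∑ p, (S.demand G h D d p : ℝ) ≤ ∑ p : Kind ι × Kind ι, (S.darts G h p.1 p.2 : ℝ) / d := by
        apply sum_le_sum
        intro p _
        refine (S.demand_le G h D d p).trans ?_
        gcongr
        exact mul_le_of_le_one_left (by positivity) (share_le_one _ _)
    _ = (∑ v, (deg (S.wrong G) v : ℝ)) / d := by
        rw [← sum_div]
        congr 1
        exact_mod_cast S.sum_sum_darts G h
    _ ≤ η * (Fintype.card V : ℝ) ^ 2 / d := by
        gcongr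
        exact hS.good.wrong_le
    _ ≤ η / c * Fintype.card V := by
        have h0 : 0 ≤ η * (Fintype.card V : ℝ) ^ 2 :=
          le_trans (sum_nonneg fun v _ => by positivity) hS.good.wrong_le
        calc η * (Fintype.card V : ℝ) ^ 2 / d
            ≤ η * (Fintype.card V : ℝ) ^ 2 / (c * Fintype.card V) := by
              gcongr
              exact hS.le_d
          _ = η / c * Fintype.card V := by field_simp

/-- A vertex with many wrong neighbours of one label can be completed to a gadget. -/
lemma exists_gadget_of_leaves (hS : S.IsCalibrated G d t D c δ s η) {U B : Finset V} {v : V}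
    {p : Kind ι × Kind ι} (hv : S.kind G (s * Fintype.card V) v = p.1) (hvU : v ∉ U)
    (hU : (#U : ℝ) ≤ 2 * t * (η / c * (Fintype.card V : ℝ))) (hB : D ≤ #B) (hBU : Disjoint B U)
    (hlab : ∀ u ∈ B, S.lab u = p.2.1) (hadj : ∀ u ∈ B, (S.wrong G).Adj v u)
    (hleaves : ∀ u ∈ B, S.heavy G (s * Fintype.card V) u = ∅ ∨
      (S.kind G (s * Fintype.card V) u = p.2 ∧ ¬ High p.1 p.2)) :
    ∃ Y B', S.IsGadget G (s * Fintype.card V) t p v Y B' ∧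
      Disjoint (insert v Y ∪ B') U := by
  have hF : (#(insert v (U ∪ S.heavySet G (s * Fintype.card V))) : ℝ) ≤
      δ / 2 * Fintype.card V := by
    have h1 : #(insert v (U ∪ S.heavySet G (s * Fintype.card V))) ≤
        #U + #(S.heavySet G (s * Fintype.card V)) + 1 :=
      (card_insert_le _ _).trans (Nat.add_le_add_right (card_union_le _ _) _)
    have h2 : (#(insert v (U ∪ S.heavySet G (s * Fintype.card V))) : ℝ) ≤
        #U + #(S.heavySet G (s * Fintype.card V)) + 1 := by exact_mod_cast h1
    have h3 := hS.card_heavySet_le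
    have h4 := hS.room
    have h5 := mul_le_mul_of_nonneg_right hS.s_le_delta hS.n_pos.le
    have h6 : (0 : ℝ) ≤ D := by positivity
    linarith
  obtain ⟨B', hB'B, hB't, Y, hYt, hYF, hYB⟩ := exists_common_neighbours (S.right G) hS.one_le_t
    hS.delta_pos hS.t_le hB (fun u _ => hS.good.le_right u) hF hS.t_pow_le
  have hYF' : ∀ y ∈ Y, y ≠ v ∧ y ∉ U ∧ S.heavy G (s * Fintype.card V) y = ∅ := by
    intro y hy
    have := disjoint_left.1 hYF hy
    rw [mem_insert, mem_union, not_or, not_or] at this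
    refine ⟨this.1, this.2.1, ?_⟩
    by_contra hcon
    exact this.2.2 (mem_filter.2 ⟨mem_univ _, hcon⟩)
  refine ⟨Y, B', ⟨hv, hB't, fun u hu => hlab u (hB'B hu), fun u hu => (hadj u (hB'B hu)).1,
    fun u hu => hleaves u (hB'B hu), hYt, fun y hy => (hYF' y hy).2.2, hYB,
    fun h => (hYF' v h).1 rfl⟩, ?_⟩
  rw [disjoint_left]
  intro x hx
  rcases mem_union.1 hx with hx | hx
  · rcases mem_insert.1 hx with rfl | hx
    · exact hvU
    · exact (hYF' x hx).2.1
  · exact disjoint_left.1 hBU (hB'B hx)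

/-- If `b` is not heavy for `a`, vertices of class `a` have few wrong neighbours in class `b`. -/
lemma card_wrong_le_of_not_high (S : Labelling V ι) (G : SimpleGraph V) (h : ℝ) {a b : Kind ι}
    (hab : ¬ High a b) {v : V} (hv : v ∈ S.kindSet G h a) :
    (#{u ∈ S.kindSet G h b | (S.wrong G).Adj v u} : ℝ) ≤ h := by
  have hva : S.kind G h v = a := (mem_filter.1 hv).2
  have h1 : b.1 ∉ S.heavy G h v := by
    have : S.heavy G h v = a.2 := congrArg Prod.snd hva
    rw [this]; exact hab
  have h2 : (#{u | (S.wrong G).Adj v u ∧ S.lab u = b.1} : ℝ) < h := by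
    by_contra hcon
    exact h1 (mem_filter.2 ⟨mem_univ _, not_lt.1 hcon⟩)
  have h3 : #{u ∈ S.kindSet G h b | (S.wrong G).Adj v u} ≤
      #{u | (S.wrong G).Adj v u ∧ S.lab u = b.1} := by
    apply card_le_card
    intro u hu
    rw [mem_filter] at hu
    exact mem_filter.2 ⟨mem_univ _, hu.2, congrArg Prod.fst (mem_filter.1 hu.1).2⟩
  have h4 : (#{u ∈ S.kindSet G h b | (S.wrong G).Adj v u} : ℝ) ≤
      #{u | (S.wrong G).Adj v u ∧ S.lab u = b.1} := by exact_mod_cast h3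
  linarith

lemma darts_le_of_not_high (S : Labelling V ι) (G : SimpleGraph V) (h : ℝ) {a b : Kind ι}
    (hab : ¬ High a b) : (S.darts G h a b : ℝ) ≤ #(S.kindSet G h a) * h := by
  unfold darts
  rw [cut_eq_sum, ← nsmul_eq_mul, ← sum_const]
  push_cast
  exact sum_le_sum fun v hv => card_wrong_le_of_not_high S G h hab hv

/-- There is room for one more gadget with a centre that has many wrong neighbours. -/
lemma exists_gadget_of_high (hS : S.IsCalibrated G d t D c δ s η) {U : Finset V}
    {g : Kind ι × Kind ι → ℕ} (hU : GadgetUnion S G (s * Fintype.card V) t U g)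
    (hg : ∀ q, g q ≤ S.demand G (s * Fintype.card V) D d q) {p : Kind ι × Kind ι}
    (hgp : g p < S.demand G (s * Fintype.card V) D d p) (hp : High p.1 p.2)
    (hUc : (#U : ℝ) ≤ 2 * t * (η / c * (Fintype.card V : ℝ))) :
    ∃ v Y B, S.IsGadget G (s * Fintype.card V) t p v Y B ∧ Disjoint (insert v Y ∪ B) U := by
  have hn := hS.n_pos
  have hd := hS.d_pos
  have hc := hS.c_pos
  have hs := hS.s_pos
  set n : ℝ := (Fintype.card V : ℝ) with hndef
  set a := p.1 with ha
  set A := S.kindSet G (s * n) a with hA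
  have hApos : (0 : ℝ) < #A := by
    by_contra hcon
    have h0 : #A = 0 := by
      have : (#A : ℝ) ≤ 0 := not_lt.1 hcon
      exact_mod_cast le_antisymm this (by positivity)
    have h1 : S.darts G (s * n) p.1 p.2 = 0 := by
      have := cut_le_card_mul_card (S.wrong G) A (S.kindSet G (s * n) p.2)
      rw [h0, zero_mul] at this
      exact Nat.le_zero.1 this
    have h2 := S.demand_le G (s * n) D d p
    rw [h1] at h2
    simp only [Nat.cast_zero, mul_zero, zero_div] at h2
    have h3 : (S.demand G (s * n) D d p : ℝ) > 0 := by exact_mod_cast Nat.zero_lt_of_lt hgp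
    linarith
  have hused : (#{v ∈ U | S.kind G (s * n) v = a} : ℝ) < #A := by
    have hx : a.2 ≠ ∅ := ne_empty_of_mem hp
    refine lt_of_le_of_lt (hU.card_filter_kind_le hx) ?_
    -- Vertices of class `a` are used as centres at most `∑ deg_wrong / d ≤ (1 - δ)|A|` times. As
    -- leaves they serve only pairs with light edges at both ends: such a pair has at most `|A| s n`
    -- darts, so it uses at most `t |A| s / (2c)` leaves. Over all pairs this is at most `δ|A|/4`.
    have h1 : ∑ q, (g q : ℝ) *
        ((if q.1 = a then 1 else 0) + if q.2 = a ∧ ¬ High q.1 q.2 then (t : ℝ) else 0) ≤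
        ∑ q : Kind ι × Kind ι, ((if q.1 = a then (S.darts G (s * n) q.1 q.2 : ℝ) / d else 0) +
          if q.2 = a then t * (#A * s / (2 * c)) else 0) := by
      apply sum_le_sum
      intro q _
      rw [mul_add]
      have hgq : (g q : ℝ) ≤ share q.1 q.2 * S.darts G (s * n) q.1 q.2 / d :=
        le_trans (by exact_mod_cast hg q) (S.demand_le G (s * n) D d q)
      apply add_le_add
      · split_ifs
        · rw [mul_one]
          refine hgq.trans ?_
          gcongr
          exact mul_le_of_le_one_left (by positivity) (share_le_one _ _)
        · simp
      · by_cases hq : q.2 = a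
        · rw [if_pos hq]
          split_ifs with hl
          · rw [mul_comm]
            gcongr
            refine hgq.trans ?_
            have hl2 := hl.2
            by_cases hr : High q.2 q.1
            · have : share q.1 q.2 = 0 := by simp [share, hl2, hr]
              rw [this, zero_mul, zero_div]
              positivity
            · have h2 : share q.1 q.2 = 1 / 2 := by simp [share, hl2, hr]
              have h3 := darts_le_of_not_high S G (s * n) hr
              rw [hq, ← hA] at h3
              rw [h2, darts_comm, hq]
              calc 1 / 2 * (S.darts G (s * n) a q.1 : ℝ) / d
                  ≤ 1 / 2 * (#A * (s * n)) / (c * n) := by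
                    gcongr
                    exact hS.le_d
                _ = #A * s / (2 * c) := by field_simp
          · rw [mul_zero]; positivity
        · rw [if_neg hq, if_neg (fun h => hq h.1), mul_zero]
    have h2 : ∑ q : Kind ι × Kind ι, (if q.1 = a then (S.darts G (s * n) q.1 q.2 : ℝ) / d else 0) =
        (∑ v ∈ A, (deg (S.wrong G) v : ℝ)) / d := by
      rw [Fintype.sum_prod_type]
      have : ∀ x : Kind ι, ∑ y : Kind ι,
          (if x = a then (S.darts G (s * n) x y : ℝ) / d else 0) =
          if x = a then (∑ y, (S.darts G (s * n) a y : ℝ)) / d else 0 := by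
        intro x
        split_ifs with hxa
        · rw [hxa, sum_div]
        · simp
      simp only [this]
      rw [sum_ite_eq' univ a, if_pos (mem_univ _)]
      congr 1
      exact_mod_cast S.sum_darts G (s * n) a
    have h3 : ∑ q : Kind ι × Kind ι, (if q.2 = a then (t : ℝ) * (#A * s / (2 * c)) else 0) =
        Fintype.card (Kind ι) * (t * (#A * s / (2 * c))) := by
      rw [Fintype.sum_prod_type]
      simp
    have h4 : (∑ v ∈ A, (deg (S.wrong G) v : ℝ)) / d ≤ #A * (1 - δ) := by
      rw [div_le_iff₀ hd, mul_assoc, ← nsmul_eq_mul, ← sum_const]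
      exact sum_le_sum fun v _ => hS.deg_wrong_le v
    have h5 : (Fintype.card (Kind ι) : ℝ) * (t * (#A * s / (2 * c))) ≤ #A * (δ / 4) := by
      have e : (Fintype.card (Kind ι) : ℝ) * (t * (#A * s / (2 * c))) =
        #A * ((2 * t * Fintype.card (Kind ι) * s) / (4 * c)) := by field_simp; ring
      rw [e]
      refine mul_le_mul_of_nonneg_left ?_ hApos.le
      rw [div_le_iff₀ (by positivity)]
      have := hS.s_le_mul
      linarith
    rw [sum_add_distrib, h2, h3] at h1
    have h6 : 0 < #A * δ := mul_pos hApos hS.delta_pos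
    linarith
  obtain ⟨v, hvA, hvU⟩ : ∃ v ∈ A, v ∉ U := by
    by_contra hcon
    push Not at hcon
    have : A ⊆ ({v ∈ U | S.kind G (s * n) v = a} : Finset V) := fun v hv =>
      mem_filter.2 ⟨hcon v hv, (mem_filter.1 hv).2⟩
    have : (#A : ℝ) ≤ #{v ∈ U | S.kind G (s * n) v = a} := by exact_mod_cast card_le_card this
    linarith
  have hva : S.kind G (s * n) v = a := (mem_filter.1 hvA).2
  set N : Finset V := {u | (S.wrong G).Adj v u ∧ S.lab u = p.2.1} with hN
  have hNc : s * n ≤ #N := by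
    have h1 : p.2.1 ∈ S.heavy G (s * n) v := by
      have : S.heavy G (s * n) v = a.2 := congrArg Prod.snd hva
      rw [this]; exact hp
    exact (mem_filter.1 h1).2
  -- The centre has `sn` wrong neighbours with the right label, more than the used and the heavy
  -- vertices together, so the leaves can be taken outside every heavy class.
  have hB : D ≤ #(N \ (U ∪ S.heavySet G (s * n))) := by
    have h1 := le_card_sdiff (U ∪ S.heavySet G (s * n)) N
    have h2 := card_union_le U (S.heavySet G (s * n))
    have h3 := hS.card_heavySet_le
    have h4 := hS.room
    have h5 : D + #U + #(S.heavySet G (s * n)) ≤ #N := by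
      have : (D : ℝ) + #U + #(S.heavySet G (s * n)) ≤ #N := by linarith
      exact_mod_cast this
    omega
  have hBm : ∀ u ∈ N \ (U ∪ S.heavySet G (s * n)), (S.wrong G).Adj v u ∧ S.lab u = p.2.1 ∧
      u ∉ U ∧ S.heavy G (s * n) u = ∅ := by
    intro u hu
    rw [mem_sdiff, mem_union, not_or] at hu
    have h1 := (mem_filter.1 hu.1).2
    refine ⟨h1.1, h1.2, hu.2.1, ?_⟩
    by_contra hcon
    exact hu.2.2 (mem_filter.2 ⟨mem_univ _, hcon⟩)
  obtain ⟨Y, B', h1, h2⟩ := hS.exists_gadget_of_leaves hva hvU hUc hB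
    (disjoint_left.2 fun u hu => (hBm u hu).2.2.1) (fun u hu => (hBm u hu).2.1)
    (fun u hu => (hBm u hu).1) (fun u hu => Or.inl (hBm u hu).2.2.2)
  exact ⟨v, Y, B', h1, h2⟩

/-- There is room for one more gadget with few wrong neighbours at both ends. -/
lemma exists_gadget_of_not_high (hS : S.IsCalibrated G d t D c δ s η) {U : Finset V}
    {g : Kind ι × Kind ι → ℕ} (hU : GadgetUnion S G (s * Fintype.card V) t U g)
    {p : Kind ι × Kind ι}
    (hgp : g p < S.demand G (s * Fintype.card V) D d p) (hp : ¬ High p.1 p.2)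
    (hg : ∀ q, g q ≤ S.demand G (s * Fintype.card V) D d p)
    (hUc : (#U : ℝ) ≤ 2 * t * (η / c * (Fintype.card V : ℝ))) :
    ∃ v Y B, S.IsGadget G (s * Fintype.card V) t p v Y B ∧ Disjoint (insert v Y ∪ B) U := by
  have hn := hS.n_pos
  have hd := hS.d_pos
  have hc := hS.c_pos
  have hs := hS.s_pos
  set n : ℝ := (Fintype.card V : ℝ) with hndef
  set k := S.demand G (s * n) D d p with hk
  have hk0 : (0 : ℝ) < k := by exact_mod_cast Nat.zero_lt_of_lt hgp
  have hkle := S.demand_le G (s * n) D d p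
  -- If only the other end were heavy, it would receive the whole share and nothing would be
  -- demanded here.
  have hp' : ¬ High p.2 p.1 := by
    intro hh
    have : share p.1 p.2 = 0 := by simp [share, hp, hh]
    rw [this, zero_mul, zero_div] at hkle
    linarith
  have hshare : share p.1 p.2 = 1 / 2 := by simp [share, hp, hp']
  set E : ℝ := (S.darts G (s * n) p.1 p.2 : ℝ) with hE
  have hElarge : 2 * D * n < E := by
    by_contra hcon
    have h1 : S.darts G (s * n) p.1 p.2 ≤ 2 * D * Fintype.card V := by
      have := not_lt.1 hcon
      rw [hE, hndef] at this
      exact_mod_cast this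
    have : k = 0 := by
      rw [hk]
      exact if_pos ⟨hp, h1⟩
    rw [this] at hk0
    simp at hk0
  -- No pair has so far received more than `k` gadgets, and `k ≤ E / (2cn)`. So `U` is small
  -- relative to `E` itself, not only relative to `n`.
  have hUE : (#U : ℝ) * (s * n) ≤ E / 4 := by
    have h1 : (#U : ℝ) = 2 * t * ∑ q, (g q : ℝ) := by exact_mod_cast hU.card_eq hS.one_le_t
    have h2 : ∑ q, (g q : ℝ) ≤ Fintype.card (Kind ι × Kind ι) * k := by
      calc ∑ q, (g q : ℝ) ≤ ∑ _q : Kind ι × Kind ι, (k : ℝ) :=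
            sum_le_sum fun q _ => by exact_mod_cast hg q
        _ = _ := by simp
    have h3 : (k : ℝ) ≤ E / (2 * (c * n)) := by
      calc (k : ℝ) ≤ 1 / 2 * E / d := by rw [hshare] at hkle; exact hkle
        _ ≤ 1 / 2 * E / (c * n) := by
          gcongr
          exact hS.le_d
        _ = _ := by field_simp
    calc (#U : ℝ) * (s * n)
        ≤ 2 * t * (Fintype.card (Kind ι × Kind ι) * (E / (2 * (c * n)))) * (s * n) := by
          rw [h1]
          gcongr
          exact h2.trans (by gcongr)
      _ = (4 * t * Fintype.card (Kind ι × Kind ι) * s) * (E / (4 * c)) := by field_simp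
      _ ≤ c * (E / (4 * c)) := by
          gcongr
          exact hS.s_le_c
      _ = E / 4 := by field_simp
  set A := S.kindSet G (s * n) p.1 with hA
  set B := S.kindSet G (s * n) p.2 with hB
  -- Vertices have at most `sn` wrong neighbours in the other class, so `U` meets at most `E/4`
  -- darts at either end. More than `Dn` of the `E` darts avoid `U`, and some centre has `D` of
  -- them.
  obtain ⟨v, hvA, hvU, hvD⟩ : ∃ v ∈ A, v ∉ U ∧ D ≤ #{u ∈ B \ U | (S.wrong G).Adj v u} := by
    by_contra hcon
    push Not at hcon
    have hsub : A ×ˢ B ⊆ ((A ∩ U) ×ˢ B) ∪ (A ×ˢ (B ∩ U)) ∪ ((A \ U) ×ˢ (B \ U)) := by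
      rintro ⟨x, y⟩ hxy
      simp only [mem_union, mem_product, mem_inter, mem_sdiff] at hxy ⊢
      tauto
    have hcut : S.darts G (s * n) p.1 p.2 ≤ cut (S.wrong G) (A ∩ U) B +
        cut (S.wrong G) A (B ∩ U) + cut (S.wrong G) (A \ U) (B \ U) := by
      unfold darts cut
      refine (card_le_card (filter_subset_filter _ hsub)).trans ?_
      rw [filter_union, filter_union]
      exact (card_union_le _ _).trans (Nat.add_le_add_right (card_union_le _ _) _)
    have hside : ∀ X : Finset V, ∀ a b : Kind ι, ¬ High a b → X ⊆ S.kindSet G (s * n) a → X ⊆ U →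
        (cut (S.wrong G) X (S.kindSet G (s * n) b) : ℝ) ≤ E / 4 := by
      intro X a b hab hXa hXU
      refine le_trans ?_ hUE
      rw [cut_eq_sum]
      push_cast
      calc ∑ v ∈ X, (#{u ∈ S.kindSet G (s * n) b | (S.wrong G).Adj v u} : ℝ)
          ≤ ∑ v ∈ X, s * n := sum_le_sum fun v hv =>
            card_wrong_le_of_not_high S G (s * n) hab (hXa hv)
        _ = #X * (s * n) := by simp
        _ ≤ #U * (s * n) := by gcongr
    have h1 := hside (A ∩ U) p.1 p.2 hp inter_subset_left inter_subset_right
    have h2 := hside (B ∩ U) p.2 p.1 hp' inter_subset_left inter_subset_right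
    rw [cut_comm] at h2
    have h3 : (cut (S.wrong G) (A \ U) (B \ U) : ℝ) ≤ n * D := by
      rw [cut_eq_sum]
      push_cast
      calc ∑ v ∈ A \ U, (#{u ∈ B \ U | (S.wrong G).Adj v u} : ℝ) ≤ ∑ v ∈ A \ U, (D : ℝ) := by
            apply sum_le_sum
            intro v hv
            rw [mem_sdiff] at hv
            exact_mod_cast (hcon v hv.1 hv.2).le
        _ = #(A \ U) * D := by simp
        _ ≤ n * D := by
          gcongr
          rw [hndef]
          exact_mod_cast card_le_univ _
    have h4 : E ≤ cut (S.wrong G) (A ∩ U) B + cut (S.wrong G) A (B ∩ U) +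
        cut (S.wrong G) (A \ U) (B \ U) := by rw [hE]; exact_mod_cast hcut
    linarith
  have hBm : ∀ u ∈ ({u ∈ B \ U | (S.wrong G).Adj v u} : Finset V), (S.wrong G).Adj v u ∧
      S.kind G (s * n) u = p.2 ∧ u ∉ U := by
    intro u hu
    rw [mem_filter, mem_sdiff] at hu
    exact ⟨hu.2, (mem_filter.1 hu.1.1).2, hu.1.2⟩
  obtain ⟨Y, B', h1, h2⟩ := hS.exists_gadget_of_leaves (mem_filter.1 hvA).2 hvU hUc hvD
    (disjoint_left.2 fun u hu => (hBm u hu).2.2)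
    (fun u hu => congrArg Prod.fst (hBm u hu).2.1)
    (fun u hu => (hBm u hu).1) (fun u hu => Or.inr ⟨(hBm u hu).2.1, hp⟩)
  exact ⟨v, Y, B', h1, h2⟩

/-- All demands can be met simultaneously. -/
lemma exists_gadgetUnion (hS : S.IsCalibrated G d t D c δ s η) :
    ∃ U, GadgetUnion S G (s * Fintype.card V) t U (S.demand G (s * Fintype.card V) D d) := by
  set k := S.demand G (s * Fintype.card V) D d with hk
  have hkey : ∀ T : Finset (Kind ι × Kind ι), ∃ U,
      GadgetUnion S G (s * Fintype.card V) t U (fun q => if q ∈ T then k q else 0) := by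
    intro T
    -- Pairs with light ends are served in order of increasing demand, as
    -- `exists_gadget_of_not_high` needs. Heavy pairs get a value above every demand and so come
    -- last.
    induction T using Finset.induction_on_max_value
      (fun q => if High q.1 q.2 then ∑ p, k p + 1 else k q) with
    | empty =>
      refine ⟨∅, ?_⟩
      simpa using GadgetUnion.empty
    | insert p T hpT hmax ih =>
      have hinner : ∀ j ≤ k p, ∃ U, GadgetUnion S G (s * Fintype.card V) t U
          (fun q => (if q ∈ T then k q else 0) + if q = p then j else 0) := by
        intro j
        induction j with
        | zero =>
          intro _
          simpa using ih
        | succ j ihj =>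
          intro hj
          obtain ⟨U, hU⟩ := ihj (by omega)
          have hgp : ((if p ∈ T then k p else 0) + if p = p then j else 0) < k p := by
            rw [if_neg hpT, if_pos rfl]; omega
          have hgk : ∀ q, ((if q ∈ T then k q else 0) + if q = p then j else 0) ≤ k q := by
            intro q
            by_cases hq : q = p
            · subst hq
              rw [if_neg hpT, if_pos rfl]; omega
            · rw [if_neg hq]
              split_ifs <;> omega
          have hUc : (#U : ℝ) ≤ 2 * t * (η / c * (Fintype.card V : ℝ)) := by
            have h1 : (#U : ℝ) = 2 * t * ∑ q : Kind ι × Kind ι,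
                (((if q ∈ T then k q else 0) + if q = p then j else 0 : ℕ) : ℝ) := by
              exact_mod_cast hU.card_eq hS.one_le_t
            rw [h1]
            gcongr
            refine le_trans ?_ (hS.sum_demand_le (s * Fintype.card V))
            exact sum_le_sum fun q _ => by exact_mod_cast hgk q
          have hone : ∃ v Y B, S.IsGadget G (s * Fintype.card V) t p v Y B ∧
              Disjoint (insert v Y ∪ B) U := by
            by_cases hp : High p.1 p.2
            · exact hS.exists_gadget_of_high hU hgk hgp hp hUc
            · refine hS.exists_gadget_of_not_high hU hgp hp ?_ hUc
              intro q
              by_cases hq : q = p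
              · subst hq
                rw [if_neg hpT, if_pos rfl, zero_add]
                exact (Nat.le_succ j).trans hj
              · rw [if_neg hq, add_zero]
                split_ifs with hqT
                · have h1 := hmax q hqT
                  rw [if_neg hp] at h1
                  split_ifs at h1
                  · have h2 : k p ≤ ∑ p, k p := single_le_sum (fun _ _ => Nat.zero_le _) (mem_univ p)
                    omega
                  · exact h1
                · exact Nat.zero_le _
          obtain ⟨v, Y, B, hgad, hdis⟩ := hone
          refine ⟨insert v Y ∪ B ∪ U, ?_⟩
          convert hU.add hgad hdis using 1
          funext q
          split_ifs <;> omega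
      obtain ⟨U, hU⟩ := hinner (k p) le_rfl
      refine ⟨U, ?_⟩
      convert hU using 1
      funext q
      by_cases hq : q = p
      · subst hq
        simp [hpT]
      · simp [hq, mem_insert]
  obtain ⟨U, hU⟩ := hkey univ
  refine ⟨U, ?_⟩
  simpa using hU

end IsCalibrated

end Labelling

/-! ### Balancing the bipartite clusters -/

namespace Labelling

section

variable {V : Type*} [Fintype V] {ι : Type*} [Fintype ι]

/-- The imbalance of a bipartite cluster as a sum over pairs of classes. -/
lemma mul_sum_sgn_eq (S : Labelling V ι) (G : SimpleGraph V) (h : ℝ) {d : ℕ}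
    (hG : ∀ v, deg G v = d) {i : ι} (hi : i ∈ S.bip) :
    d * ∑ v, sgn i (S.lab v) = ∑ p : Kind ι × Kind ι,
      share p.1 p.2 * S.darts G h p.1 p.2 * (sgn i p.1.1 + sgn i p.2.1) := by
  rw [← S.sum_sgn_mul_deg_wrong G hG hi, ← sum_fiberwise univ (S.kind G h)]
  have h1 : ∀ a : Kind ι, ∑ v with S.kind G h v = a,
      sgn i (S.lab v) * (deg (S.wrong G) v : ℝ) = ∑ b, sgn i a.1 * S.darts G h a b := by
    intro a
    rw [← mul_sum]
    have h2 : ∑ b, (S.darts G h a b : ℝ) = ∑ v ∈ S.kindSet G h a, (deg (S.wrong G) v : ℝ) := by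
      exact_mod_cast S.sum_darts G h a
    rw [h2, mul_sum]
    apply sum_congr rfl
    intro v hv
    have h3 : S.lab v = a.1 := congrArg Prod.fst (mem_filter.1 hv).2
    rw [h3]
  simp_rw [h1]
  -- Each dart is split between its two orientations; exchanging the roles of `a` and `b` in the
  -- second half collects both signs at one pair.
  have h2 : ∀ a b : Kind ι, sgn i a.1 * (S.darts G h a b : ℝ) =
      share a b * S.darts G h a b * sgn i a.1 + share b a * S.darts G h b a * sgn i a.1 := by
    intro a b
    rw [S.darts_comm G h b a, ← add_mul, ← add_mul, share_add_share]
    ring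
  have h3 : ∑ p : Kind ι × Kind ι,
      share p.1 p.2 * S.darts G h p.1 p.2 * (sgn i p.1.1 + sgn i p.2.1) =
      ∑ a : Kind ι, ∑ b : Kind ι, share a b * S.darts G h a b * (sgn i a.1 + sgn i b.1) :=
    Fintype.sum_prod_type _
  rw [h3]
  simp_rw [h2, mul_add, sum_add_distrib]
  refine congrArg₂ (· + ·) rfl ?_
  rw [sum_comm]

/-- After removing the gadgets, the sides of each bipartite cluster have almost the same size. -/
lemma IsCalibrated.abs_sum_sgn_le {S : Labelling V ι} {G : SimpleGraph V} {d t D : ℕ}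
    {c δ s η : ℝ} (hS : S.IsCalibrated G d t D c δ s η) {U : Finset V}
    (hU : GadgetUnion S G (s * Fintype.card V) t U (S.demand G (s * Fintype.card V) D d))
    {i : ι} (hi : i ∈ S.bip) :
    |∑ v ∈ Uᶜ, sgn i (S.lab v)| ≤
      Fintype.card (Kind ι × Kind ι) * (2 * (2 * D / c + 1)) := by
  have hd := hS.d_pos
  have hc := hS.c_pos
  set h : ℝ := s * Fintype.card V
  have h1 : ∑ v, sgn i (S.lab v) = ∑ p : Kind ι × Kind ι,
      share p.1 p.2 * S.darts G h p.1 p.2 / d * (sgn i p.1.1 + sgn i p.2.1) := by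
    have := S.mul_sum_sgn_eq G h hS.deg_eq hi
    rw [mul_comm, ← eq_div_iff hd.ne', sum_div] at this
    rw [this]
    exact sum_congr rfl fun p _ => by ring
  have h2 := hU.sum_sgn hS.one_le_t hi
  -- The fractional demands would cancel the imbalance exactly, so only the rounding errors remain.
  have h3 : ∑ v ∈ Uᶜ, sgn i (S.lab v) = ∑ p : Kind ι × Kind ι,
      (share p.1 p.2 * S.darts G h p.1 p.2 / d - S.demand G h D d p) *
        (sgn i p.1.1 + sgn i p.2.1) := by
    have := sum_add_sum_compl U (fun v => sgn i (S.lab v))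
    simp_rw [sub_mul]
    rw [sum_sub_distrib, ← h1, ← h2]
    linarith
  rw [h3]
  refine (abs_sum_le_sum_abs _ _).trans ?_
  have h4 : ∀ p : Kind ι × Kind ι,
      |(share p.1 p.2 * S.darts G h p.1 p.2 / d - S.demand G h D d p) *
        (sgn i p.1.1 + sgn i p.2.1)| ≤ 2 * (2 * D / c + 1) := by
    intro p
    have h5 := S.demand_le G h D d p
    have h6 := S.le_demand_add G h D d hc hS.card_pos hS.le_d p
    have h7 : |sgn i p.1.1 + sgn i p.2.1| ≤ 2 :=
      (abs_add_le _ _).trans (by linarith [abs_sgn_le i p.1.1, abs_sgn_le i p.2.1])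
    rw [abs_mul, abs_of_nonneg (by linarith), mul_comm]
    gcongr
    linarith
  calc _ ≤ ∑ _p : Kind ι × Kind ι, 2 * (2 * (D : ℝ) / c + 1) := sum_le_sum fun p _ => h4 p
    _ = _ := by simp

/-- Two disjoint sets can be made equal in size by deleting as many elements as their sizes
differ by. -/
lemma exists_trim {α : Type*} {A B : Finset α} (hAB : Disjoint A B) {C : ℝ} (hC : |(#A : ℝ) - #B| ≤ C) :
    ∃ X ⊆ A ∪ B, (#X : ℝ) ≤ C ∧ #(A \ X) = #(B \ X) := by
  have key : ∀ A B : Finset α, Disjoint A B → #B ≤ #A → |(#A : ℝ) - #B| ≤ C →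
      ∃ X ⊆ A ∪ B, (#X : ℝ) ≤ C ∧ #(A \ X) = #(B \ X) := by
    intro A B hAB hle hC
    obtain ⟨X, hXA, hX⟩ := exists_subset_card_eq (Nat.sub_le #A #B)
    refine ⟨X, hXA.trans subset_union_left, ?_, ?_⟩
    · rw [hX, Nat.cast_sub hle]
      exact (le_abs_self _).trans hC
    · rw [card_sdiff_of_subset hXA, sdiff_eq_self_of_disjoint (hAB.symm.mono_right hXA), hX]
      omega
  rcases le_total #B #A with hle | hle
  · exact key A B hAB hle hC
  · rw [abs_sub_comm] at hC
    obtain ⟨X, h1, h2, h3⟩ := key B A hAB.symm hle hC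
    exact ⟨X, union_comm A B ▸ h1, h2, h3.symm⟩

lemma IsCalibrated.exists_balanced {S : Labelling V ι} {G : SimpleGraph V} {d t D : ℕ}
    {c δ s η : ℝ} (hS : S.IsCalibrated G d t D c δ s η) :
    ∃ L X : Finset V,
      (#X : ℝ) ≤ Fintype.card ι * (Fintype.card (Kind ι × Kind ι) * (2 * (2 * D / c + 1))) ∧
      (#L : ℝ) ≤ 2 * t * (η / c * (Fintype.card V : ℝ)) ∧
      HasPerfectPacking (completeBipartiteGraph (Fin t) (Fin t)) (G.induce (L : Set V)) ∧
      ∀ i ∈ S.bip, #{v ∈ S.cluster i \ (L ∪ X) | S.side v = true} =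
        #{v ∈ S.cluster i \ (L ∪ X) | S.side v = false} := by
  obtain ⟨U, hU⟩ := hS.exists_gadgetUnion
  set C : ℝ := Fintype.card (Kind ι × Kind ι) * (2 * (2 * D / c + 1)) with hCdef
  have hC0 : 0 ≤ C := by
    have := hS.c_pos
    positivity
  let A : ι → Bool → Finset V := fun i b => {v ∈ S.cluster i \ U | S.side v = b}
  have hA : ∀ i b v, v ∈ A i b ↔ (S.cl v = i ∧ v ∉ U) ∧ S.side v = b := by
    intro i b v
    simp [A, mem_cluster]
  have hdisj : ∀ i, Disjoint (A i true) (A i false) := by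
    intro i
    rw [disjoint_left]
    intro v h1 h2
    rw [hA] at h1 h2
    simp [h1.2] at h2
  have htrim : ∀ i, ∃ X ⊆ A i true ∪ A i false, (#X : ℝ) ≤ C ∧
      (i ∈ S.bip → #(A i true \ X) = #(A i false \ X)) := by
    intro i
    by_cases hi : i ∈ S.bip
    · have h1 := hS.abs_sum_sgn_le hU hi
      have h2 : ∑ v ∈ Uᶜ, sgn i (S.lab v) = #(A i true) - #(A i false) := by
        have h3 : ∀ b, (#(A i b) : ℝ) = ∑ v ∈ Uᶜ, if S.cl v = i ∧ S.side v = b then 1 else 0 := by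
          intro b
          rw [sum_boole]
          congr 2
          ext v
          rw [hA, mem_filter, mem_compl]
          tauto
        rw [h3, h3, ← sum_sub_distrib]
        apply sum_congr rfl
        intro v _
        unfold sgn lab
        by_cases hv : S.cl v = i
        · cases S.side v <;> simp [hv]
        · simp [hv]
      rw [h2] at h1
      obtain ⟨X, h3, h4, h5⟩ := exists_trim (hdisj i) h1
      exact ⟨X, h3, h4, fun _ => h5⟩
    · exact ⟨∅, by simp, by simpa using hC0, fun h => absurd h hi⟩
  choose X hXsub hXcard hXeq using htrim
  refine ⟨U, univ.biUnion X, ?_, ?_, ?_, ?_⟩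
  · calc (#(univ.biUnion X) : ℝ) ≤ ∑ i, (#(X i) : ℝ) := by exact_mod_cast card_biUnion_le
      _ ≤ ∑ _i : ι, C := sum_le_sum fun i _ => hXcard i
      _ = _ := by simp
  · have h1 : (#U : ℝ) = 2 * t * ∑ q, (S.demand G (s * Fintype.card V) D d q : ℝ) := by
      exact_mod_cast hU.card_eq hS.one_le_t
    rw [h1]
    gcongr
    exact hS.sum_demand_le _
  · obtain ⟨𝒬, h1, h2, h3⟩ := hU.exists_blocks hS.one_le_t
    exact hasPerfectPacking_of_blocks G t 𝒬 U h1 h2 h3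
  · intro i hi
    have h1 : ∀ b, ({v ∈ S.cluster i \ (U ∪ univ.biUnion X) | S.side v = b} : Finset V) =
        A i b \ X i := by
      intro b
      ext v
      rw [mem_filter, mem_sdiff, mem_sdiff, mem_union, mem_cluster, hA, mem_biUnion]
      constructor
      · rintro ⟨⟨h1, h2⟩, h3⟩
        push Not at h2
        exact ⟨⟨⟨h1, h2.1⟩, h3⟩, h2.2 i (mem_univ _)⟩
      · rintro ⟨⟨⟨h1, h2⟩, h3⟩, h4⟩
        refine ⟨⟨h1, ?_⟩, h3⟩
        -- The set trimmed from another cluster lies inside that cluster, so it does not disturb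
        -- this one.
        rintro (h5 | ⟨j, _, h5⟩)
        · exact h2 h5
        · have h6 := mem_union.1 (hXsub j h5)
          rw [hA, hA] at h6
          have : j = i := by
            rcases h6 with h6 | h6
            · rw [← h6.1.1, h1]
            · rw [← h6.1.1, h1]
          exact h4 (this ▸ h5)
    rw [h1, h1]
    exact hXeq i hi

end

universe u

/-- In a good labelling, boundedly many vertices and a few disjoint copies of `K_{t,t}` can be
removed so that all bipartite clusters become balanced. -/
lemma exists_balanced (ι : Type*) [Fintype ι] {c δ : ℝ} (hc : 0 < c) (hδ : 0 < δ) {t : ℕ}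
    (ht : 1 ≤ t) :
    ∃ C > (0 : ℝ), ∃ θ > (0 : ℝ), ∃ N : ℕ, ∀ (V : Type u) [Fintype V] (G : SimpleGraph V) (d : ℕ)
      (S : Labelling V ι) (η : ℝ), N ≤ Fintype.card V → (∀ v, deg G v = d) →
      c * (Fintype.card V : ℝ) ≤ d → η ≤ θ → S.IsGood G η δ →
      ∃ L X : Finset V, (#X : ℝ) ≤ C ∧ (#L : ℝ) ≤ 2 * t * (η / c * (Fintype.card V : ℝ)) ∧
        HasPerfectPacking (completeBipartiteGraph (Fin t) (Fin t)) (G.induce (L : Set V)) ∧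
        ∀ i ∈ S.bip, #{v ∈ S.cluster i \ (L ∪ X) | S.side v = true} =
          #{v ∈ S.cluster i \ (L ∪ X) | S.side v = false} := by
  have ht0 : (0 : ℝ) < t := by exact_mod_cast ht
  set D : ℕ := ⌈4 * (t : ℝ) / δ⌉₊ with hD
  set q : ℝ := (Fintype.card (Kind ι) : ℝ) with hq
  set q₂ : ℝ := (Fintype.card (Kind ι × Kind ι) : ℝ) with hq₂
  have hq0 : 0 ≤ q := by positivity
  have hq₂0 : 0 ≤ q₂ := by positivity
  set s : ℝ := min (c / (4 * t * (q₂ + 1))) (min (c * δ / (2 * t * (q + 1))) (δ / 2)) with hs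
  have hs0 : 0 < s := by positivity
  have hs1 : s ≤ c / (4 * t * (q₂ + 1)) := min_le_left _ _
  have hs2 : s ≤ c * δ / (2 * t * (q + 1)) := (min_le_right _ _).trans (min_le_left _ _)
  have hs3 : s ≤ δ / 2 := (min_le_right _ _).trans (min_le_right _ _)
  rw [le_div_iff₀ (by positivity)] at hs1 hs2
  set θ : ℝ := s / (2 * (2 * t / c + 1 / s)) with hθ
  -- The bound on `X` involves only `ι`, `c`, `δ` and `t`, so `ζ` can later be chosen small in terms
  -- of it.
  refine ⟨Fintype.card ι * (q₂ * (2 * (2 * D / c + 1))) + 1, by positivity, θ, by positivity,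
    ⌈(t : ℝ) * 2 ^ (D + 2) / δ⌉₊ + ⌈2 * ((D : ℝ) + 1) / s⌉₊ + 1, ?_⟩
  intro V _ G d S η hN hG hd hη hS
  have hNr : (⌈(t : ℝ) * 2 ^ (D + 2) / δ⌉₊ : ℝ) + ⌈2 * ((D : ℝ) + 1) / s⌉₊ + 1 ≤
      Fintype.card V := by exact_mod_cast hN
  have hn0 : (0 : ℝ) < Fintype.card V := lt_of_lt_of_le (by positivity) hNr
  have hN1 : (t : ℝ) * 2 ^ (D + 2) / δ ≤ Fintype.card V := by
    have h1 := Nat.le_ceil ((t : ℝ) * 2 ^ (D + 2) / δ)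
    have h2 : (0 : ℝ) ≤ ⌈2 * ((D : ℝ) + 1) / s⌉₊ := by positivity
    linarith
  have hN2 : 2 * ((D : ℝ) + 1) / s ≤ Fintype.card V := by
    have h1 := Nat.le_ceil (2 * ((D : ℝ) + 1) / s)
    have h2 : (0 : ℝ) ≤ ⌈(t : ℝ) * 2 ^ (D + 2) / δ⌉₊ := by positivity
    linarith
  rw [div_le_iff₀ hδ] at hN1
  rw [div_le_iff₀ hs0] at hN2
  have hcal : S.IsCalibrated G d t D c δ s η :=
    { card_pos := by exact_mod_cast hn0
      c_pos := hc
      delta_pos := hδ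
      s_pos := hs0
      one_le_t := ht
      deg_eq := hG
      le_d := hd
      good := hS
      t_le := by
        have := Nat.le_ceil (4 * (t : ℝ) / δ)
        rw [div_le_iff₀ hδ] at this
        linarith
      t_pow_le := by linarith
      s_le_c := by
        have : 0 ≤ s * (4 * t) := by positivity
        rw [← hq₂]
        linarith
      s_le_mul := by
        have : 0 ≤ s * (2 * t) := by positivity
        rw [← hq]
        linarith
      s_le_delta := hs3
      room := by
        have h1 : η * (2 * t / c + 1 / s) ≤ s / 2 := by
          calc η * (2 * t / c + 1 / s) ≤ θ * (2 * t / c + 1 / s) := by gcongr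
            _ = s / 2 := by rw [hθ]; field_simp
        have h2 := mul_le_mul_of_nonneg_right h1 hn0.le
        have h3 : 2 * t * (η / c * (Fintype.card V : ℝ)) + η / s * (Fintype.card V : ℝ) =
          η * (2 * t / c + 1 / s) * Fintype.card V := by ring
        rw [h3]
        linarith }
  obtain ⟨L, X, h1, h2⟩ := hcal.exists_balanced
  exact ⟨L, X, h1.trans (by linarith), h2⟩

end Labelling

/-! ### Stability under deleting few vertices -/

section Deletion

variable {V : Type*}

/-- Removing few vertices does not create very sparse cuts. -/
lemma NoSparseCuts.sdiff {H : SimpleGraph V} {Z M : Finset V} {ζ : ℝ} (hζ : 0 < ζ)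
    (h : NoSparseCuts (H.induce (Z : Set V)) (4 * ζ)) (hM : (#M : ℝ) ≤ ζ * #(Z \ M)) :
    NoSparseCuts (H.induce ((Z \ M : Finset V) : Set V)) ζ := by
  rw [noSparseCuts_induce_iff] at h ⊢
  -- With `A` the smaller side, `|M| ≤ ζ|Z \ M| ≤ 2ζ|B|`. Deleting `M` costs at most `2ζ|A||B|` of
  -- more than `4ζ|A||B|` edges.
  have key : ∀ A B : Finset V, A.Nonempty → B.Nonempty → Disjoint A B → A ∪ B = Z \ M →
      #A ≤ #B → ζ * #A * #B < cut H A B := by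
    intro A B hA hB hdisj hAB hle
    have hAZ : A ⊆ Z := (hAB ▸ subset_union_left).trans sdiff_subset
    have hBZ : B ⊆ Z \ A := by
      intro v hv
      rw [mem_sdiff]
      exact ⟨((hAB ▸ subset_union_right).trans sdiff_subset : B ⊆ Z) hv, disjoint_right.1 hdisj hv⟩
    have h1 := h A hAZ hA (hB.mono hBZ)
    have h2 : cut H A (Z \ A) ≤ cut H A B + #A * #M := by
      have hsub : Z \ A ⊆ B ∪ M := by
        intro v hv
        rw [mem_sdiff] at hv
        by_cases hvM : v ∈ M
        · exact mem_union_right _ hvM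
        · have : v ∈ A ∪ B := hAB ▸ mem_sdiff.2 ⟨hv.1, hvM⟩
          exact mem_union_left _ ((mem_union.1 this).resolve_left hv.2)
      exact (cut_mono H subset_rfl hsub).trans ((cut_union_right_le H A B M).trans
        (Nat.add_le_add_left (cut_le_card_mul_card H A M) _))
    have h2' : (cut H A (Z \ A) : ℝ) ≤ cut H A B + #A * #M := by exact_mod_cast h2
    have hA0 : (0 : ℝ) < #A := by exact_mod_cast hA.card_pos
    have hB0 : (0 : ℝ) < #B := by exact_mod_cast hB.card_pos
    have h3 : (#(Z \ M) : ℝ) ≤ 2 * #B := by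
      rw [← hAB, card_union_of_disjoint hdisj]
      have : (#A : ℝ) ≤ #B := by exact_mod_cast hle
      push_cast
      linarith
    have h4 : (#M : ℝ) ≤ ζ * (2 * #B) := hM.trans (by gcongr)
    have h5 : (#A : ℝ) * #M ≤ #A * (ζ * (2 * #B)) := by gcongr
    have h6 : 4 * ζ * #A * #B ≤ 4 * ζ * #A * #(Z \ A) := by gcongr
    have h7 : 0 < ζ * #A * #B := by positivity
    nlinarith
  intro A hAZ hA hB
  rcases le_total #A #((Z \ M) \ A) with hle | hle
  · exact key A _ hA hB disjoint_sdiff (union_sdiff_of_subset hAZ) hle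
  · have := key _ A hB hA sdiff_disjoint (sdiff_union_of_subset hAZ) hle
    rw [cut_comm]
    linarith

/-- Removing few vertices keeps a graph far from bipartite. -/
lemma IsFarFromBipartite.sdiff [Fintype V] {H : SimpleGraph V} {Z M : Finset V} {m m' : ℝ}
    (h : IsFarFromBipartite (H.induce (Z : Set V)) m)
    (hM : m' + #M * (Fintype.card V : ℝ) ≤ m) :
    IsFarFromBipartite (H.induce ((Z \ M : Finset V) : Set V)) m' := by
  intro E hE hbip
  obtain ⟨φ⟩ := hbip
  let incl : ((Z \ M : Finset V) : Set V) → (Z : Set V) := fun x =>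
    ⟨x.1, (mem_sdiff.1 x.2).1⟩
  let P : Set (↥(Z : Set V) × ↥(Z : Set V)) := {p | p.1.1 ∈ M}
  let T : Set (Sym2 (Z : Set V)) := (fun p : ↥(Z : Set V) × ↥(Z : Set V) => s(p.1, p.2)) '' P
  have hT : (T.ncard : ℝ) ≤ #M * Fintype.card V := by
    have h1 : T.ncard ≤ P.ncard := Set.ncard_image_le (Set.toFinite _)
    have h2 : P.ncard ≤ ((M ×ˢ univ : Finset (V × V)) : Set (V × V)).ncard := by
      refine Set.ncard_le_ncard_of_injOn (fun p => (p.1.1, p.2.1)) ?_ ?_ (Set.toFinite _)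
      · intro p hp
        exact mem_coe.2 (mem_product.2 ⟨hp, mem_univ _⟩)
      · rintro ⟨a, b⟩ _ ⟨a', b'⟩ _ hab
        simp only [Prod.mk.injEq] at hab
        exact Prod.ext (Subtype.ext hab.1) (Subtype.ext hab.2)
    rw [Set.ncard_coe_finset, card_product, card_univ] at h2
    exact_mod_cast h1.trans h2
  -- Deleting in addition every edge that meets `M` makes the larger graph bipartite, at a cost of
  -- at most `|M| n` edges.
  let E' : Set (Sym2 (Z : Set V)) :=
    Sym2.map incl '' E ∪ (T ∩ (H.induce (Z : Set V)).edgeSet)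
  have h1 : m ≤ (E'.ncard : ℝ) := by
    apply h
    · rintro e (⟨e', he', rfl⟩ | he)
      · have := hE he'
        revert this
        refine Sym2.ind (fun x y => ?_) e'
        intro hxy
        exact hxy
      · exact he.2
    · refine ⟨SimpleGraph.Coloring.mk
        (fun x => if hx : x.1 ∈ M then 0 else φ ⟨x.1, mem_sdiff.2 ⟨x.2, hx⟩⟩) ?_⟩
      intro x y hxy
      rw [SimpleGraph.deleteEdges_adj] at hxy
      obtain ⟨hadj, hnot⟩ := hxy
      have hxM : x.1 ∉ M := fun hx => hnot (Or.inr ⟨⟨(x, y), hx, rfl⟩, hadj⟩)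
      have hyM : y.1 ∉ M := fun hy => hnot (Or.inr ⟨⟨(y, x), hy, Sym2.eq_swap⟩, hadj⟩)
      rw [dif_neg hxM, dif_neg hyM]
      apply φ.valid
      rw [SimpleGraph.deleteEdges_adj]
      refine ⟨hadj, fun hmem => hnot (Or.inl ⟨_, hmem, ?_⟩)⟩
      rfl
  have h2 : E'.ncard ≤ E.ncard + T.ncard := by
    refine (Set.ncard_union_le _ _).trans (add_le_add ?_ ?_)
    · exact Set.ncard_image_le (Set.toFinite _)
    · exact Set.ncard_le_ncard Set.inter_subset_left (Set.toFinite _)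
  have h3 : (E'.ncard : ℝ) ≤ E.ncard + T.ncard := by exact_mod_cast h2
  linarith

lemma averageDegree_induce (H : SimpleGraph V) (Z : Finset V) :
    averageDegree (H.induce (Z : Set V)) = (∑ v ∈ Z, (#{u ∈ Z | H.Adj v u} : ℝ)) / #Z := by
  unfold averageDegree
  have hcard : Fintype.card (Z : Set V) = #Z := by simp
  rw [hcard]
  congr 1
  rw [← sum_coe_sort Z]
  apply sum_congr rfl
  intro v _
  congr 1
  rw [← SimpleGraph.card_neighborFinset_eq_degree]
  refine card_bij (fun u _ => u.1) ?_ ?_ ?_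
  · intro u hu
    rw [SimpleGraph.mem_neighborFinset] at hu
    exact mem_filter.2 ⟨u.2, hu⟩
  · intro u _ u' _ huu
    exact Subtype.ext huu
  · intro u hu
    rw [mem_filter] at hu
    exact ⟨⟨u, hu.1⟩, by rw [SimpleGraph.mem_neighborFinset]; exact hu.2, rfl⟩

namespace Labelling

variable [Fintype V] {ι : Type*}

lemma isBalancedBipartite_of_card_eq {S : Labelling V ι} {G : SimpleGraph V} {i : ι}
    (hi : i ∈ S.bip) {Z : Finset V} (hZ : Z ⊆ S.cluster i)
    (hcard : #{v ∈ Z | S.side v = true} = #{v ∈ Z | S.side v = false}) :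
    IsBalancedBipartite ((S.right G).induce (Z : Set V)) := by
  have hn : ∀ b, ({x | S.side x.1 = b} : Set (Z : Set V)).ncard = #{v ∈ Z | S.side v = b} := by
    intro b
    rw [← Set.ncard_coe_finset]
    refine Set.ncard_congr (fun x _ => x.1) ?_ ?_ ?_
    · intro x hx
      exact mem_coe.2 (mem_filter.2 ⟨x.2, hx⟩)
    · intro x y _ _ hxy
      exact Subtype.ext hxy
    · intro v hv
      have hv' := mem_filter.1 (mem_coe.1 hv)
      exact ⟨⟨v, hv'.1⟩, hv'.2, rfl⟩
  refine ⟨{x | S.side x.1 = true}, {x | S.side x.1 = false}, ⟨?_, ?_⟩, ?_, ?_⟩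
  · rw [Set.disjoint_left]
    intro x hx hx'
    simp only [Set.mem_ofPred_eq] at hx hx'
    simp [hx] at hx'
  · intro x y hxy
    have h1 : S.cl x.1 = i := mem_cluster.1 (hZ x.2)
    have h2 := hxy.2.2 (h1 ▸ hi)
    simp only [Set.mem_ofPred_eq]
    revert h2
    change S.side x.1 ≠ S.side y.1 → _
    cases S.side x.1 <;> cases S.side y.1 <;> simp
  · ext x
    simp
  · rw [hn, hn]
    exact hcard

/-- Removing few vertices from a cluster keeps its average degree almost as large as `d`. -/
lemma IsGood.le_averageDegree {S : Labelling V ι} {G : SimpleGraph V} {η δ μ : ℝ} {d : ℕ}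
    (hS : S.IsGood G η δ) (hη : 0 ≤ η) (hδ : 0 < δ) (hμ : 0 ≤ μ) (hV : 0 < Fintype.card V)
    (hG : ∀ v, deg G v = d) (i : ι) {M : Finset V} (hM : (#M : ℝ) ≤ μ * Fintype.card V)
    (hZ : δ / 2 * (Fintype.card V : ℝ) ≤ #(S.cluster i \ M)) :
    d - (2 * μ / δ + 4 * η / δ ^ 2) * #(S.cluster i \ M) ≤
      averageDegree ((S.right G).induce ((S.cluster i \ M : Finset V) : Set V)) := by
  set n : ℝ := (Fintype.card V : ℝ) with hn
  have hn0 : 0 < n := by rw [hn]; exact_mod_cast hV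
  set Z := S.cluster i \ M with hZdef
  have hZ0 : (0 : ℝ) < #Z := lt_of_lt_of_le (by positivity) hZ
  rw [averageDegree_induce, le_div_iff₀ hZ0]
  have h1 : ∀ v ∈ Z, (d : ℝ) - deg (S.wrong G) v - #M ≤ #{u ∈ Z | (S.right G).Adj v u} := by
    intro v hv
    have h2 := S.deg_add_deg G v
    rw [hG] at h2
    have h3 : deg (S.right G) v ≤ #{u ∈ Z | (S.right G).Adj v u} + #M := by
      have : ({u | (S.right G).Adj v u} : Finset V) ⊆ {u ∈ Z | (S.right G).Adj v u} ∪ M := by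
        intro u hu
        have hu' := (mem_filter.1 hu).2
        by_cases huM : u ∈ M
        · exact mem_union_right _ huM
        · refine mem_union_left _ (mem_filter.2 ⟨mem_sdiff.2 ⟨?_, huM⟩, hu'⟩)
          exact S.cluster_closed G i v (mem_sdiff.1 hv).1 u hu'
      exact (card_le_card this).trans (card_union_le _ _)
    have h4 : (deg (S.right G) v : ℝ) + deg (S.wrong G) v = d := by exact_mod_cast h2
    have h5 : (deg (S.right G) v : ℝ) ≤ #{u ∈ Z | (S.right G).Adj v u} + #M := by
      exact_mod_cast h3
    linarith
  have h2 : #Z * (d : ℝ) - η * n ^ 2 - #Z * #M ≤ ∑ v ∈ Z, (#{u ∈ Z | (S.right G).Adj v u} : ℝ) := by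
    refine le_trans ?_ (sum_le_sum h1)
    rw [sum_sub_distrib, sum_sub_distrib, sum_const, sum_const, nsmul_eq_mul, nsmul_eq_mul]
    have h3 : ∑ v ∈ Z, (deg (S.wrong G) v : ℝ) ≤ η * n ^ 2 := by
      refine le_trans ?_ hS.wrong_le
      apply sum_le_sum_of_subset_of_nonneg (subset_univ _)
      intros; positivity
    linarith
  have h3 : n ≤ 2 / δ * #Z := by
    rw [div_mul_eq_mul_div, le_div_iff₀ hδ]
    linarith
  have h4 : η * n ^ 2 ≤ η * (2 / δ * #Z) ^ 2 := by gcongr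
  have h5 : (#Z : ℝ) * #M ≤ #Z * (μ * (2 / δ * #Z)) := by
    gcongr
    exact hM.trans (by gcongr)
  have e : (d - (2 * μ / δ + 4 * η / δ ^ 2) * #Z) * #Z =
      #Z * (d : ℝ) - η * (2 / δ * #Z) ^ 2 - #Z * (μ * (2 / δ * #Z)) := by
    field_simp
    ring
  rw [e]
  linarith

end Labelling

end Deletion

/-! ### Choice of the constants -/

lemma deg_eq_degree {V : Type*} [Fintype V] (G : SimpleGraph V) [DecidableRel G.Adj] (v : V) :
    deg G v = G.degree v := by
  unfold deg
  rw [← SimpleGraph.card_neighborFinset_eq_degree]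
  congr 1
  ext u
  simp

/-- The conditions that relate the parameters of a terminal labelling. -/
structure IsHierarchy (f₁ f₂ : ℝ → ℝ) (u a b δ θ C η ζ γ : ℝ) : Prop where
  eta_le_f : b * η ≤ f₁ ζ
  zeta_le_f : ζ ≤ f₂ γ
  gamma_le : γ ≤ u
  eta_le_one : b * η ≤ 1
  eta_le_zeta : a * η ≤ ζ * δ / 2
  eta_le_gamma : a * η ≤ γ
  eta_le_delta : a * η ≤ δ / 2
  eta_le_theta : η ≤ θ
  zeta_le : ζ ≤ 1 / 4
  zeta_le_const : C ≤ 16 / ζ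

/-- The constants are chosen in the order `γ`, `ζ`, `η`, so each condition bounds the new one by
positive quantities already known. -/
lemma exists_isHierarchy {f₁ f₂ : ℝ → ℝ} (hf₁ : IsHierarchyFunction f₁)
    (hf₂ : IsHierarchyFunction f₂) {u a b δ θ C : ℝ} (hu : 0 < u) (ha : 0 < a) (hb : 0 < b)
    (hδ : 0 < δ) (hθ : 0 < θ) (hC : 0 < C) (e : ℝ) (he : 0 < e) :
    ∃ η ζ γ : ℝ, 0 < η ∧ 0 < ζ ∧ 0 < γ ∧ η ≤ e ∧ ζ ≤ e ∧ γ ≤ e ∧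
      IsHierarchy f₁ f₂ u a b δ θ C η ζ γ := by
  obtain ⟨γ, hγ, hγe, hγu, hγ1⟩ : ∃ γ : ℝ, 0 < γ ∧ γ ≤ e ∧ γ ≤ u ∧ γ ≤ 1 :=
    ⟨min e (min u 1), by positivity, min_le_left _ _,
      (min_le_right _ _).trans (min_le_left _ _), (min_le_right _ _).trans (min_le_right _ _)⟩
  have hf₂γ : 0 < f₂ γ := (hf₂.mapsTo ⟨hγ, hγ1⟩).1
  obtain ⟨ζ, hζ, hζe, hζf, hζ4, hζC⟩ :
      ∃ ζ : ℝ, 0 < ζ ∧ ζ ≤ e ∧ ζ ≤ f₂ γ ∧ ζ ≤ 1 / 4 ∧ ζ ≤ 16 / C :=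
    ⟨min (min e (f₂ γ)) (min (1 / 4) (16 / C)), by positivity,
      (min_le_left _ _).trans (min_le_left _ _), (min_le_left _ _).trans (min_le_right _ _),
      (min_le_right _ _).trans (min_le_left _ _), (min_le_right _ _).trans (min_le_right _ _)⟩
  have hf₁ζ : 0 < f₁ ζ := (hf₁.mapsTo ⟨hζ, by linarith⟩).1
  obtain ⟨η, hη, h1, h2, h3, h4⟩ : ∃ η : ℝ, 0 < η ∧ η ≤ e ∧ η ≤ θ ∧ η ≤ min (f₁ ζ) 1 / b ∧
      η ≤ min (ζ * δ / 2) (min γ (δ / 2)) / a :=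
    ⟨min (min e θ) (min (min (f₁ ζ) 1 / b) (min (ζ * δ / 2) (min γ (δ / 2)) / a)), by positivity,
      (min_le_left _ _).trans (min_le_left _ _), (min_le_left _ _).trans (min_le_right _ _),
      (min_le_right _ _).trans (min_le_left _ _), (min_le_right _ _).trans (min_le_right _ _)⟩
  rw [le_div_iff₀ hb, mul_comm, le_min_iff] at h3
  rw [le_div_iff₀ ha, mul_comm, le_min_iff, le_min_iff] at h4
  refine ⟨η, ζ, γ, hη, hζ, hγ, h1, hζe, hγe, h3.1, hζf, hγu, h3.2, h4.1, h4.2.1, h4.2.2, h2,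
    hζ4, ?_⟩
  rw [le_div_iff₀ hC] at hζC
  rw [le_div_iff₀ hζ]
  linarith

/-- A bound for the size of the exceptional set. -/
lemma const_le_exceptional {C ζ c : ℝ} {t r : ℕ} (hζ : 0 < ζ) (hζ4 : ζ ≤ 1 / 4)
    (hC : C ≤ 16 / ζ) (hc : 0 < c) (hc1 : c ≤ 1) (ht : 1 ≤ t) (hr : 1 ≤ r) :
    C ≤ 64 * (r : ℝ) ^ 2 * ((t : ℝ) / c) * (Real.exp 1 / (8 * ζ)) ^ t := by
  have he : (2 : ℝ) ≤ Real.exp 1 := by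
    have := Real.add_one_le_exp (1 : ℝ)
    linarith
  -- Only `e ≥ 2` and the first power are needed: `64 / (4ζ) = 16/ζ`, and the remaining factors are
  -- at least `1`.
  have h1 : 1 / (4 * ζ) ≤ Real.exp 1 / (8 * ζ) := by
    rw [div_le_div_iff₀ (by positivity) (by positivity)]
    nlinarith
  have h2 : 1 ≤ 1 / (4 * ζ) := by
    rw [le_div_iff₀ (by positivity)]
    linarith
  have h3 : Real.exp 1 / (8 * ζ) ≤ (Real.exp 1 / (8 * ζ)) ^ t :=
    le_self_pow₀ (h2.trans h1) (by omega)
  have h4 : (1 : ℝ) ≤ (t : ℝ) / c := by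
    rw [le_div_iff₀ hc]
    have : (1 : ℝ) ≤ t := by exact_mod_cast ht
    linarith
  have h5 : (1 : ℝ) ≤ (r : ℝ) ^ 2 := one_le_pow₀ (by exact_mod_cast hr)
  have h6 : (1 : ℝ) ≤ (r : ℝ) ^ 2 * ((t : ℝ) / c) := one_le_mul_of_one_le_of_one_le h5 h4
  calc C ≤ 16 / ζ := hC
    _ = 64 * 1 * (1 / (4 * ζ)) := by field_simp; norm_num
    _ ≤ 64 * ((r : ℝ) ^ 2 * ((t : ℝ) / c)) * (Real.exp 1 / (8 * ζ)) ^ t := by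
      gcongr
      exact h1.trans h3
    _ = _ := by ring

end DenseRegular

/-! ### Assembling the theorem -/

open DenseRegular DenseRegular.Labelling in
theorem mainTheorem5
    (f₀ f₁ f₂ f₃ : ℝ → ℝ)
    (hf₀ : DenseRegular.IsHierarchyFunction f₀) (hf₁ : DenseRegular.IsHierarchyFunction f₁)
    (hf₂ : DenseRegular.IsHierarchyFunction f₂) (hf₃ : DenseRegular.IsHierarchyFunction f₃)
    (c : ℝ) (hc₀ : 0 < c) (hc₁ : c ≤ 1) (t : ℕ) (ht : 2 ≤ t) :
    ∃ N : ℕ, ∀ n₀ : ℕ, N ≤ n₀ →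
      ∀ (V : Type*) [Fintype V] [DecidableEq V] (G : SimpleGraph V) [DecidableRel G.Adj]
        (n d : ℕ), Fintype.card V = n → n₀ ≤ n → c * (n : ℝ) ≤ (d : ℝ) →
        G.IsRegularOfDegree d →
      ∃ (η ζ γ : ℝ) (r : ℕ),
        0 < η ∧ 0 < ζ ∧ 0 < γ ∧ 0 < r ∧ r ≤ ⌈1 / c⌉₊ ∧
        -- `1 / n₀ ≪ η ≪ ζ ≪ γ ≪ c, 1 / t`
        1 / (n₀ : ℝ) ≤ f₀ η ∧ η ≤ f₁ ζ ∧ ζ ≤ f₂ γ ∧ γ ≤ f₃ (min c (1 / (t : ℝ))) ∧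
        ∃ (Z : Fin r → Finset V) (L : Finset V) (G' : SimpleGraph V),
          (∀ i, (Z i).Nonempty) ∧
          (∀ i j, i ≠ j → Disjoint (Z i) (Z j)) ∧
          (∀ i, Disjoint (Z i) L) ∧
          G' ≤ G ∧
          ((Finset.univ \ (Finset.univ.biUnion Z ∪ L)).card : ℝ) ≤
            64 * (r : ℝ) ^ 2 * ((t : ℝ) / c) * (Real.exp 1 / (8 * ζ)) ^ t ∧
          (∀ i, (d : ℝ) - η * ((Z i).card : ℝ) ≤
            DenseRegular.averageDegree (G'.induce (Z i : Set V))) ∧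
          (∀ i, DenseRegular.NoSparseCuts (G'.induce (Z i : Set V)) ζ) ∧
          (∀ i, DenseRegular.IsBalancedBipartite (G'.induce (Z i : Set V)) ∨
            DenseRegular.IsFarFromBipartite (G'.induce (Z i : Set V)) (γ * (n : ℝ) ^ 2)) ∧
          DenseRegular.HasPerfectPacking (completeBipartiteGraph (Fin t) (Fin t))
            (G.induce (L : Set V)) := by
  have ht0 : (0 : ℝ) < t := by exact_mod_cast (by omega : 0 < t)
  obtain ⟨R, hR⟩ : ∃ R : ℕ, R = ⌈1 / c⌉₊ := ⟨_, rfl⟩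
  have hRc : 1 / c ≤ R := hR ▸ Nat.le_ceil _
  -- Each of at most `2R` steps divides the right degrees by `4`, starting from `c n`.
  obtain ⟨δ, hδ, hδ4⟩ : ∃ δ : ℝ, 0 < δ ∧ 4 ^ (2 * R) * δ = c :=
    ⟨c / 4 ^ (2 * R), by positivity, by field_simp⟩
  obtain ⟨C, hC, θ, hθ, N₁, hbal⟩ := exists_balanced (Fin (R + 1)) hc₀ hδ (by omega : 1 ≤ t)
  have hu : 0 < f₃ (min c (1 / (t : ℝ))) :=
    (hf₃.mapsTo ⟨by positivity, (min_le_left _ _).trans hc₁⟩).1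
  -- At most `aηn` vertices leave the clusters: `2tηn/c` in the packing, and `ηn` for the trimmed
  -- set once `n ≥ C/η₀`. The resulting loss in average degree is `bη|Z|`, so `bη` serves as the `η`
  -- of the theorem.
  obtain ⟨a, ha⟩ : ∃ a : ℝ, a = 2 * t / c + 1 := ⟨_, rfl⟩
  obtain ⟨b, hb⟩ : ∃ b : ℝ, b = 2 * a / δ + 4 / δ ^ 2 := ⟨_, rfl⟩
  have ha0 : 0 < a := by rw [ha]; positivity
  have hb0 : 0 < b := by rw [hb]; positivity
  obtain ⟨η₀, hη₀, hterm⟩ := exists_isTerminal _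
    (exists_isHierarchy hf₁ hf₂ (u := f₃ (min c (1 / (t : ℝ)))) hu ha0 hb0 hδ hθ hC) hc₀ hδ hRc
    (2 * R)
  -- The scale found later satisfies `η ≥ η₀`, so the value of `f₀` at this fixed point determines
  -- how large `n₀` must be. The minimum with `1` keeps it in the domain where `f₀` is monotone.
  have hx₀ : min (b * η₀) 1 ∈ Set.Ioc (0 : ℝ) 1 := ⟨by positivity, min_le_right _ _⟩
  have hf₀x := (hf₀.mapsTo hx₀).1
  refine ⟨N₁ + ⌈C / η₀⌉₊ + ⌈1 / f₀ (min (b * η₀) 1)⌉₊ + 1, ?_⟩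
  intro n₀ hn₀ V _ inst G _ n d hn hn₀n hd hG
  obtain rfl : inst = fun a b => Classical.propDecidable (a = b) := Subsingleton.elim _ _
  classical
  subst hn
  have hV : 0 < Fintype.card V := by omega
  have hdeg : ∀ v, deg G v = d := fun v => (deg_eq_degree G v).trans (hG v)
  -- the trivial labelling
  let S₀ : Labelling V (Fin (R + 1)) := ⟨fun _ => 0, fun _ => true, ∅⟩
  have hright₀ : S₀.right G = G := by
    ext u v
    simp [S₀, Labelling.right]
  have hS₀ : S₀.IsGood G η₀ (4 ^ (2 * R) * δ) := by
    constructor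
    · have h0 : ∀ v, deg (S₀.wrong G) v = 0 := by
        intro v
        have := S₀.deg_add_deg G v
        rw [hright₀] at this
        omega
      simp only [h0]
      simp only [Nat.cast_zero, Finset.sum_const_zero]
      positivity
    · intro v
      rw [hright₀, hdeg, hδ4]
      exact hd
  have hpot₀ : 1 ≤ S₀.potential := by
    obtain ⟨v⟩ := Fintype.card_pos_iff.1 hV
    have : 0 < S₀.indices.card := Finset.card_pos.2 ⟨0, mem_indices.2 ⟨v, rfl⟩⟩
    unfold Labelling.potential
    omega
  obtain ⟨η, ζ, γ, S, hη₀η, hζ, hγ, hrel, hS, hind, hT⟩ :=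
    hterm V G d S₀ hV hdeg hd hS₀ (by omega)
  have hη : 0 < η := hη₀.trans_le hη₀η
  obtain ⟨L, X, hX, hL, hpack, hside⟩ := hbal V G d S η (by omega) hdeg hd hrel.eta_le_theta hS
  have hn0 : (0 : ℝ) < Fintype.card V := by exact_mod_cast hV
  -- few vertices are removed
  have hM : ((L ∪ X).card : ℝ) ≤ a * η * Fintype.card V := by
    have h1 : ((L ∪ X).card : ℝ) ≤ L.card + X.card := by exact_mod_cast Finset.card_union_le _ _
    have h2 : C ≤ η * Fintype.card V := by
      have h3 : C / η₀ ≤ Fintype.card V := by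
        refine (Nat.le_ceil _).trans ?_
        exact_mod_cast (by omega : ⌈C / η₀⌉₊ ≤ Fintype.card V)
      rw [div_le_iff₀ hη₀] at h3
      nlinarith
    have e : a * η * Fintype.card V =
        2 * t * (η / c * (Fintype.card V : ℝ)) + η * Fintype.card V := by rw [ha]; ring
    rw [e]
    linarith
  have hZlarge : ∀ i ∈ S.indices,
      δ / 2 * (Fintype.card V : ℝ) ≤ (S.cluster i \ (L ∪ X)).card := by
    intro i hi
    have h1 := hS.le_card_cluster hi
    have h2 := Finset.le_card_sdiff (L ∪ X) (S.cluster i)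
    have h3 : ((S.cluster i).card : ℝ) ≤ (S.cluster i \ (L ∪ X)).card + (L ∪ X).card := by
      exact_mod_cast (by omega : (S.cluster i).card ≤ (S.cluster i \ (L ∪ X)).card + (L ∪ X).card)
    have h4 := mul_le_mul_of_nonneg_right hrel.eta_le_delta hn0.le
    linarith
  have hr : 0 < S.indices.card := by
    obtain ⟨v⟩ := Fintype.card_pos_iff.1 hV
    exact Finset.card_pos.2 ⟨S.cl v, mem_indices.2 ⟨v, rfl⟩⟩
  have hf₀η : 1 / (n₀ : ℝ) ≤ f₀ (b * η) := by
    have h1 : f₀ (min (b * η₀) 1) ≤ f₀ (b * η) := by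
      refine hf₀.monotoneOn hx₀ ⟨by positivity, hrel.eta_le_one⟩ ((min_le_left _ _).trans ?_)
      gcongr
    refine le_trans ?_ h1
    have h2 : 1 / f₀ (min (b * η₀) 1) ≤ n₀ := by
      refine (Nat.le_ceil _).trans ?_
      exact_mod_cast (by omega : ⌈1 / f₀ (min (b * η₀) 1)⌉₊ ≤ n₀)
    have h3 : (0 : ℝ) < n₀ := by exact_mod_cast (by omega : 0 < n₀)
    rw [div_le_iff₀ hf₀x] at h2
    rw [div_le_iff₀ h3]
    linarith
  let e := S.indices.equivFin.symm
  refine ⟨b * η, ζ, γ, S.indices.card, by positivity, hζ, hγ, hr, hR ▸ hind, hf₀η, hrel.eta_le_f,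
    hrel.zeta_le_f, hrel.gamma_le, fun j => S.cluster (e j).1 \ (L ∪ X), L, S.right G,
    ?_, ?_, ?_, ?_, ?_, ?_, ?_, ?_, hpack⟩
  · intro j
    rw [← Finset.card_pos]
    have h1 := hZlarge _ (e j).2
    have h2 : 0 < δ / 2 * (Fintype.card V : ℝ) := by positivity
    exact_mod_cast h2.trans_le h1
  · intro j j' hjj
    rw [Finset.disjoint_left]
    intro v hv hv'
    have h1 := mem_cluster.1 (Finset.mem_sdiff.1 hv).1
    have h2 := mem_cluster.1 (Finset.mem_sdiff.1 hv').1
    exact hjj (e.injective (Subtype.ext (h1.symm.trans h2)))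
  · intro j
    rw [Finset.disjoint_left]
    intro v hv hvL
    exact (Finset.mem_sdiff.1 hv).2 (Finset.mem_union_left _ hvL)
  · intro u v huv
    exact huv.1
  · refine le_trans ?_ (const_le_exceptional hζ hrel.zeta_le hrel.zeta_le_const hc₀ hc₁
      (by omega) hr)
    refine le_trans ?_ hX
    have : Finset.univ \ (Finset.univ.biUnion (fun j => S.cluster (e j).1 \ (L ∪ X)) ∪ L) ⊆ X := by
      intro v hv
      by_contra hvX
      refine (Finset.mem_sdiff.1 hv).2 ?_
      by_cases hvL : v ∈ L
      · exact Finset.mem_union_right _ hvL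
      · refine Finset.mem_union_left _ (Finset.mem_biUnion.2
          ⟨e.symm ⟨S.cl v, mem_indices.2 ⟨v, rfl⟩⟩, Finset.mem_univ _, Finset.mem_sdiff.2 ⟨?_, ?_⟩⟩)
        · rw [mem_cluster, Equiv.apply_symm_apply]
        · rw [Finset.mem_union]
          exact fun h => h.elim hvL hvX
    exact_mod_cast Finset.card_le_card this
  · intro j
    have h1 := hS.le_averageDegree hη.le hδ (by positivity) hV hdeg (e j).1 hM (hZlarge _ (e j).2)
    have h2 : 2 * (a * η) / δ + 4 * η / δ ^ 2 = b * η := by rw [hb]; ring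
    rwa [h2] at h1
  · intro j
    -- The terminal labelling has `4ζ` and `2γ` in place of `ζ` and `γ`; the slack pays for the
    -- deleted vertices here and in the bipartite distance below.
    refine NoSparseCuts.sdiff hζ (hT _ (e j).2).1 (hM.trans ?_)
    have h1 := hZlarge _ (e j).2
    have h2 := mul_le_mul_of_nonneg_right hrel.eta_le_zeta hn0.le
    have h3 := mul_le_mul_of_nonneg_left h1 hζ.le
    linarith
  · intro j
    rcases (hT _ (e j).2).2 with hb | hfar
    · exact Or.inl (isBalancedBipartite_of_card_eq hb Finset.sdiff_subset (hside _ hb))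
    · refine Or.inr (hfar.sdiff ?_)
      have h1 := hM.trans (mul_le_mul_of_nonneg_right hrel.eta_le_gamma hn0.le)
      have h2 := mul_le_mul_of_nonneg_right h1 hn0.le
      linarith
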